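/- Let $M\ge 0$ and $n\ge 0$ be integers and let $\nu_1,\dots,\nu_M$ be non-negative integers. Define weight functions recursively by $$g_j^{(0)}(x)=x^{j}e^{-x^2},\qquad g_j^{(m)}(x)=\int_0^\infty \frac{dy}{y}\,y^{\nu_m}e^{-y}\,g_j^{(m-1)}(x/y)\quad(m=1,\dots,M),$$ bi-moments $b_{k,\ell}=\int_{-\infty}^\infty x^k g_\ell^{(M)}(x)\,dx$, and, with $B_{2n}=(b_{k,\ell})_{k,\ell=0}^{2n-1}$, $B_{2n}^{\rm even}=(b_{2k,2\ell})_{k,\ell=0}^{n-1}$, $B_{2n}^{\rm odd}=(b_{2k+1,2\ell+1})_{k,\ell=0}^{n-1}$, the correlation kernel and its even and odd parts $$K_{2n}(x,y)=\sum_{k,\ell=0}^{2n-1}(B_{2n}^{-1})_{\ell,k}\,x^kg_\ell^{(M)}(y),$$ $$K_{2n}^{\rm even}(x,y)=\sum_{k,\ell=0}^{n-1}\big((B_{2n}^{\rm even})^{-1}\big)_{\ell,k}\,x^{2k}g_{2\ell}^{(M)}(y),\qquad K_{2n}^{\rm odd}(x,y)=\sum_{k,\ell=0}^{n-1}\big((B_{2n}^{\rm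 odd})^{-1}\big)_{\ell,k}\,x^{2k+1}g_{2\ell+1}^{(M)}(y).$$ These are well defined for $y\neq 0$ (the integrals defining $g_j^{(m)}(x)$, $x\ne0$, and $b_{k,\ell}$ converge absolutely and the three matrices are invertible), and $K_{2n}=K_{2n}^{\rm even}+K_{2n}^{\rm odd}$. Let $-1<c<0$ and let $\Sigma$ be a closed piecewise $C^1$ contour lying in $\{\operatorname{Re}s>c\}$, avoiding the points $0,1,\dots,2n-1$ and having winding number $-1$ around each of them. Then for all real $x,y\ne0$ $$K_{2n}^{\rm even}(x,y)=\frac{1}{2(2\pi i)^2}\int_{c-i\infty}^{c+i\infty}dt\oint_\Sigma ds\,\frac{|x|^{s}|y|^{-t-1}}{s-t}\,\frac{\Gamma(-\frac s2)\Gamma(\frac{t+1}2)}{\Gamma(-\frac t2)\Gamma(\frac{s+1}2)}\,\frac{\Gamma(\frac{2n-t}2)}{\Gamma(\frac{2n-s}2)}\prod_{m=1}^M\frac{\Gamma(\nu_m+t+1)}{\Gamma(\nu_m+s+1)},$$ $$K_{2n}^{\rm odd}(x,y)=\frac{\operatorname{sgn}(xy)}{2(2\pi i)^2}\int_{c-i\infty}^{c+i\infty}dt\oint_\Sigma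 ds\,\frac{|x|^{s}|y|^{-t-1}}{s-t}\,\frac{\Gamma(\frac{1-s}2)\Gamma(\frac{t+2}2)}{\Gamma(\frac{1-t}2)\Gamma(\frac{s+2}2)}\,\frac{\Gamma(\frac{2n-t+1}2)}{\Gamma(\frac{2n-s+1}2)}\prod_{m=1}^M\frac{\Gamma(\nu_m+t+1)}{\Gamma(\nu_m+s+1)},$$ and both double integrals converge absolutely. -/

import Mathlib

noncomputable section

namespace HermiteProduct

/-- The weight functions `g_j^{(m)}` of the product ensemble with parameters `ν 1, ν 2, …`:
`g_j^{(0)}(x) = x^j exp(-x²)` and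
`g_j^{(m)}(x) = ∫_0^∞ (dy / y) y^{ν_m} e^{-y} g_j^{(m-1)}(x / y)`.
The value `ν 0` is never used. -/
def weight (ν : ℕ → ℕ) : ℕ → ℕ → ℝ → ℝ
  | 0, j, x => x ^ j * Real.exp (-x ^ 2)
  | m + 1, j, x =>
      ∫ y in Set.Ioi (0 : ℝ), y⁻¹ * y ^ ν (m + 1) * Real.exp (-y) * weight ν m j (x / y)

/-- The bi-moments `b_{k,ℓ}^{(M)} = ∫ x^k g_ℓ^{(M)}(x) dx`. -/
def bimoment (ν : ℕ → ℕ) (M k l : ℕ) : ℝ := ∫ x : ℝ, x ^ k * weight ν M l x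

/-- The bi-moment matrix `B_n^{(M)} = (b_{k,ℓ})`, `0 ≤ k, ℓ ≤ n - 1`. -/
def bimomentMatrix (ν : ℕ → ℕ) (M n : ℕ) : Matrix (Fin n) (Fin n) ℝ :=
  Matrix.of fun k l => bimoment ν M k l

/-- The even block `(b_{2k,2ℓ})`, where `2k, 2ℓ` run over the even numbers in `{0, …, n - 1}`. -/
def bimomentMatrixEven (ν : ℕ → ℕ) (M n : ℕ) :
    Matrix (Fin ((n + 1) / 2)) (Fin ((n + 1) / 2)) ℝ :=
  Matrix.of fun k l => bimoment ν M (2 * k) (2 * l)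

/-- The odd block `(b_{2k+1,2ℓ+1})`, where `2k+1, 2ℓ+1` run over the odd numbers in
`{0, …, n - 1}`. -/
def bimomentMatrixOdd (ν : ℕ → ℕ) (M n : ℕ) : Matrix (Fin (n / 2)) (Fin (n / 2)) ℝ :=
  Matrix.of fun k l => bimoment ν M (2 * k + 1) (2 * l + 1)

/-- The correlation kernel `K_n(x, y) = ∑_{k,ℓ} (B_n^{-1})_{ℓ,k} x^k g_ℓ^{(M)}(y)`. -/
def kernel (ν : ℕ → ℕ) (M n : ℕ) (x y : ℝ) : ℝ :=
  ∑ k : Fin n, ∑ l : Fin n,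
    (bimomentMatrix ν M n)⁻¹ l k * x ^ (k : ℕ) * weight ν M l y

/-- The even part of the correlation kernel. -/
def kernelEven (ν : ℕ → ℕ) (M n : ℕ) (x y : ℝ) : ℝ :=
  ∑ k : Fin ((n + 1) / 2), ∑ l : Fin ((n + 1) / 2),
    (bimomentMatrixEven ν M n)⁻¹ l k * x ^ (2 * (k : ℕ)) * weight ν M (2 * l) y

/-- The odd part of the correlation kernel. -/
def kernelOdd (ν : ℕ → ℕ) (M n : ℕ) (x y : ℝ) : ℝ :=
  ∑ k : Fin (n / 2), ∑ l : Fin (n / 2),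
    (bimomentMatrixOdd ν M n)⁻¹ l k * x ^ (2 * (k : ℕ) + 1) * weight ν M (2 * l + 1) y

/-- Closed, piecewise continuously differentiable contours, parametrised by `[0, 1]`. -/
structure IsClosedContour (γ : ℝ → ℂ) : Prop where
  continuousOn : ContinuousOn γ (Set.Icc 0 1)
  closed : γ 0 = γ 1
  piecewise : ∃ (N : ℕ) (a : ℕ → ℝ), Monotone a ∧ a 0 = 0 ∧ a N = 1 ∧
    ∀ i < N, ContDiffOn ℝ 1 γ (Set.Icc (a i) (a (i + 1)))

/-- The contour integral `∮_γ f(s) ds`. -/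
def contourIntegral (γ : ℝ → ℂ) (f : ℂ → ℂ) : ℂ := ∫ u in (0 : ℝ)..1, f (γ u) * deriv γ u

/-- The winding number of a closed contour around a point off the contour. -/
def windingNumber (γ : ℝ → ℂ) (z : ℂ) : ℂ :=
  (2 * Real.pi * Complex.I)⁻¹ * contourIntegral γ fun s => (s - z)⁻¹

/-- The closed contour `γ` encircles `0, 1, …, N - 1` once in the negative (clockwise) direction
and lies in the open half-plane `Re s > c`. -/
structure Encircles (γ : ℝ → ℂ) (N : ℕ) (c : ℝ) : Prop where
  isClosedContour : IsClosedContour γ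
  re_gt : ∀ u ∈ Set.Icc (0 : ℝ) 1, c < (γ u).re
  ne_natCast : ∀ k < N, ∀ u ∈ Set.Icc (0 : ℝ) 1, γ u ≠ (k : ℂ)
  windingNumber_eq : ∀ k < N, windingNumber γ (k : ℂ) = -1

/-- The integral `∫_{c-i∞}^{c+i∞} f(t) dt` along an upward vertical line. -/
def verticalIntegral (c : ℝ) (f : ℂ → ℂ) : ℂ :=
  Complex.I * ∫ τ : ℝ, f (c + τ * Complex.I)

/-- Absolute convergence of `∫_{c-i∞}^{c+i∞} dt ∮_γ ds F(s, t)`. -/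
def AbsolutelyConvergent (c : ℝ) (γ : ℝ → ℂ) (F : ℂ → ℂ → ℂ) : Prop :=
  MeasureTheory.Integrable
    (fun p : ℝ × ℝ => F (γ p.2) (c + p.1 * Complex.I) * deriv γ p.2)
    (MeasureTheory.volume.prod (MeasureTheory.volume.restrict (Set.Icc (0 : ℝ) 1)))

/-- The integrand for the even kernel. -/
def integrandEven (ν : ℕ → ℕ) (M n : ℕ) (x y : ℝ) (s t : ℂ) : ℂ :=
  ((|x| : ℝ) : ℂ) ^ s * ((|y| : ℝ) : ℂ) ^ (-t - 1) / (s - t)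
    * (Complex.Gamma (-s / 2) * Complex.Gamma ((t + 1) / 2)
        / (Complex.Gamma (-t / 2) * Complex.Gamma ((s + 1) / 2)))
    * (Complex.Gamma ((2 * n - t) / 2) / Complex.Gamma ((2 * n - s) / 2))
    * ∏ m ∈ Finset.Icc 1 M, Complex.Gamma (ν m + t + 1) / Complex.Gamma (ν m + s + 1)

/-- The integrand for the odd kernel. -/
def integrandOdd (ν : ℕ → ℕ) (M n : ℕ) (x y : ℝ) (s t : ℂ) : ℂ :=
  ((|x| : ℝ) : ℂ) ^ s * ((|y| : ℝ) : ℂ) ^ (-t - 1) / (s - t)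
    * (Complex.Gamma ((1 - s) / 2) * Complex.Gamma ((t + 2) / 2)
        / (Complex.Gamma ((1 - t) / 2) * Complex.Gamma ((s + 2) / 2)))
    * (Complex.Gamma ((2 * n - t + 1) / 2) / Complex.Gamma ((2 * n - s + 1) / 2))
    * ∏ m ∈ Finset.Icc 1 M, Complex.Gamma (ν m + t + 1) / Complex.Gamma (ν m + s + 1)

end HermiteProduct

end

/-!
The weights are multiplicative convolutions of `x ^ j * exp (-x ^ 2)` with Gamma densities, so on
the half-line the Mellin transform of `weight ν m j` is `½ Γ((s + j)/2) ∏ Γ(ν_i + s)`. Mellin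
inversion (`weight_eq_mellinInv`) represents a weight as an integral over any line `Re s = σ > 0`.
Bounding that integral gives `|g(x)| ≤ C |x| ^ (-σ)` for every `σ > 0`, hence all the integrability
statements. The values of the Mellin transform at the positive integers are the bi-moments
(`integral_Ioi_pow_mul_weight`, `bimoment_eq`).

By parity the bi-moment matrix splits into its even and odd blocks. With `ε = 0` or `ε = 1` for the
even or odd block and `β = ε + 1/2`, the entries of a block are `Γ(k + l + β) D_k`. Since
`Γ(k + l + β) / Γ(k + β)` is the value at `X = k` of the shifted factorial `(X + β)_l`, the block is
invertible by a Vandermonde determinant, and the columns of its inverse are the coefficients of the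
Lagrange basis polynomials of the nodes `0, …, n - 1` in the basis `(X + β)_l`
(`sum_inv_gammaHankel_mul_Gamma`).

In the double integral the Gamma quotients in `s` reduce to an entire function divided by
`∏ (i - (s - ε)/2)`. The partial fraction expansion `prod_sub_div_prod_sub` has Lagrange basis
polynomials in `(t - ε)/2` as its coefficients, and Cauchy's theorem in the half-plane `Re s > c`
evaluates the contour integral (`contourIntegral_integrand`). Expanding these polynomials by means
of the inverse matrix turns the line integral into inverse Mellin transforms of the weights
(`residue_eq_sum_mellinWeight`), and the kernel results.
-/

noncomputable section

open MeasureTheory Set Filter Topology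

namespace HermiteProduct

/-! ### Contour integrals over closed piecewise `C¹` contours -/

theorem IsClosedContour.exists_differentiableAt_norm_deriv_le {γ : ℝ → ℂ}
    (h : IsClosedContour γ) :
    ∃ S : Set ℝ, S.Countable ∧ ∃ C : ℝ, ∀ u ∈ Ioo (0 : ℝ) 1 \ S,
      DifferentiableAt ℝ γ u ∧ ‖deriv γ u‖ ≤ C := by
  obtain ⟨N, a, -, ha0, haN, hd⟩ := h.piecewise
  have hbd : ∀ i : ℕ, ∃ C : ℝ, 0 ≤ C ∧ (i < N → ∀ u ∈ Ioo (a i) (a (i + 1)),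
      DifferentiableAt ℝ γ u ∧ ‖deriv γ u‖ ≤ C) := by
    intro i
    by_cases hi : i < N ∧ a i < a (i + 1)
    · obtain ⟨C, hC⟩ := isCompact_Icc.exists_bound_of_continuousOn
        ((hd i hi.1).continuousOn_derivWithin (uniqueDiffOn_Icc hi.2) le_rfl)
      refine ⟨max C 0, le_max_right _ _, fun _ u hu => ?_⟩
      have hmem : Icc (a i) (a (i + 1)) ∈ 𝓝 u := Icc_mem_nhds hu.1 hu.2
      refine ⟨((hd i hi.1).differentiableOn one_ne_zero).differentiableAt hmem, ?_⟩
      rw [← derivWithin_of_mem_nhds hmem]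
      exact (hC u (Ioo_subset_Icc_self hu)).trans (le_max_left _ _)
    · exact ⟨0, le_rfl, fun hN u hu => absurd ⟨hN, hu.1.trans hu.2⟩ hi⟩
  choose C hC0 hC using hbd
  refine ⟨range a, countable_range a, ∑ i ∈ Finset.range N, C i, fun u hu => ?_⟩
  -- the first node to the right of `u` closes the piece that contains `u`
  have hex : ∃ j, u < a j := ⟨N, by rw [haN]; exact hu.1.2⟩
  classical
  have hspec := Nat.find_spec hex
  have hpos : Nat.find hex ≠ 0 := by
    intro h0
    rw [h0, ha0] at hspec
    exact absurd hspec hu.1.1.not_gt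
  obtain ⟨i, hi⟩ := Nat.exists_eq_succ_of_ne_zero hpos
  rw [hi] at hspec
  have hiN : i < N := by
    have : Nat.find hex ≤ N := Nat.find_min' hex (by rw [haN]; exact hu.1.2)
    omega
  have hle : a i ≤ u := not_lt.1 (Nat.find_min hex (by omega : i < Nat.find hex))
  have hne : a i ≠ u := fun he => hu.2 ⟨i, he⟩
  obtain ⟨h1, h2⟩ := hC i hiN u ⟨lt_of_le_of_ne hle hne, hspec⟩
  exact ⟨h1, h2.trans (Finset.single_le_sum (fun j _ => hC0 j) (Finset.mem_range.2 hiN))⟩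

theorem IsClosedContour.exists_ae_norm_deriv_le {γ : ℝ → ℂ} (h : IsClosedContour γ) :
    ∃ C : ℝ, ∀ᵐ u ∂(volume.restrict (Icc (0 : ℝ) 1)), ‖deriv γ u‖ ≤ C := by
  obtain ⟨S, hS, C, hC⟩ := h.exists_differentiableAt_norm_deriv_le
  refine ⟨C, ?_⟩
  rw [restrict_Ioo_eq_restrict_Icc.symm]
  filter_upwards [ae_restrict_mem measurableSet_Ioo,
    ae_restrict_of_ae (hS.ae_notMem volume)] with u hu huS
  exact (hC u ⟨hu, huS⟩).2

theorem IsClosedContour.integrableOn_mul_deriv {γ : ℝ → ℂ} (h : IsClosedContour γ) {g : ℝ → ℂ}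
    (hg : ContinuousOn g (Icc 0 1)) :
    IntegrableOn (fun u => g u * deriv γ u) (Icc 0 1) := by
  obtain ⟨C, hC⟩ := h.exists_ae_norm_deriv_le
  exact (hg.integrableOn_Icc).mul_bdd (measurable_deriv γ).aestronglyMeasurable hC

theorem IsClosedContour.intervalIntegrable_mul_deriv {γ : ℝ → ℂ} (h : IsClosedContour γ)
    {g : ℝ → ℂ} (hg : ContinuousOn g (Icc 0 1)) :
    IntervalIntegrable (fun u => g u * deriv γ u) volume 0 1 := by
  rw [intervalIntegrable_iff_integrableOn_Icc_of_le zero_le_one]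
  exact h.integrableOn_mul_deriv hg

/-- A curve has zero velocity at almost every time that it spends at a given point: the times
at which it passes through the point with non-zero velocity are isolated. -/
theorem ae_eq_imp_deriv_eq_zero (γ : ℝ → ℂ) (z : ℂ) :
    ∀ᵐ u : ℝ, γ u = z → deriv γ u = 0 := by
  have hc : {u | γ u = z ∧ deriv γ u ≠ 0}.Countable := by
    have : DiscreteTopology {u | γ u = z ∧ deriv γ u ≠ 0} := by
      rw [discreteTopology_subtype_iff]
      rintro u ⟨-, hu⟩
      have hd : HasDerivAt γ (deriv γ u) u :=
        (differentiableAt_of_deriv_ne_zero hu).hasDerivAt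
      have := hd.eventually_ne (c := z) hu
      rw [← disjoint_iff, disjoint_principal_right]
      filter_upwards [this] with w hw hw'
      exact hw hw'.1
    exact (countable_coe_iff.1 (TopologicalSpace.separableSpace_iff_countable.1 inferInstance))
  filter_upwards [hc.ae_notMem volume] with u hu h
  by_contra h0
  exact hu ⟨h, h0⟩

theorem contourIntegral_congr {γ : ℝ → ℂ} {f g : ℂ → ℂ}
    (h : ∀ᵐ u ∂(volume.restrict (Icc (0 : ℝ) 1)), f (γ u) * deriv γ u = g (γ u) * deriv γ u) :
    contourIntegral γ f = contourIntegral γ g := by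
  unfold contourIntegral
  rw [intervalIntegral.integral_of_le zero_le_one, intervalIntegral.integral_of_le zero_le_one,
    ← integral_Icc_eq_integral_Ioc, ← integral_Icc_eq_integral_Ioc]
  exact integral_congr_ae h

/-- Cauchy's theorem in a half-plane. Discs that touch the boundary line exhaust the half-plane,
so one of them contains the contour, and there the integrand has a primitive. -/
theorem IsClosedContour.contourIntegral_eq_zero {γ : ℝ → ℂ} (h : IsClosedContour γ) {c : ℝ}
    (hre : ∀ u ∈ Icc (0 : ℝ) 1, c < (γ u).re) {f : ℂ → ℂ}
    (hf : DifferentiableOn ℂ f {s | c < s.re}) : contourIntegral γ f = 0 := by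
  have hcont : ContinuousOn
      (fun u => (Complex.normSq (γ u) - c ^ 2) / (2 * ((γ u).re - c))) (Icc 0 1) := by
    have h1 := h.continuousOn
    refine ContinuousOn.div ((Complex.continuous_normSq.comp_continuousOn h1).sub
      continuousOn_const) (continuousOn_const.mul
        ((Complex.continuous_re.comp_continuousOn h1).sub continuousOn_const)) ?_
    intro u hu
    have := hre u hu
    have : 0 < (γ u).re - c := by linarith
    positivity
  obtain ⟨R₀, hR₀⟩ := isCompact_Icc.exists_bound_of_continuousOn hcont
  set R : ℝ := max R₀ c + 1 with hR
  have hRc : 0 < R - c := by have := le_max_right R₀ c; linarith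
  have hball : Metric.ball (R : ℂ) (R - c) ⊆ {s | c < s.re} := by
    intro s hs
    have h1 : |(s - R).re| < R - c := by
      refine (Complex.abs_re_le_norm _).trans_lt ?_
      rwa [Metric.mem_ball, dist_eq_norm] at hs
    have h2 := (abs_lt.1 h1).1
    simp only [Complex.sub_re, Complex.ofReal_re] at h2
    change c < s.re
    linarith
  have hγ : ∀ u ∈ Icc (0 : ℝ) 1, γ u ∈ Metric.ball (R : ℂ) (R - c) := by
    intro u hu
    have h1 := hre u hu
    have h2 : (Complex.normSq (γ u) - c ^ 2) / (2 * ((γ u).re - c)) < R := by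
      have := (le_abs_self _).trans (hR₀ u hu)
      have h3 := le_max_left R₀ c
      linarith
    rw [div_lt_iff₀ (by linarith), Complex.normSq_apply] at h2
    rw [Metric.mem_ball, dist_eq_norm, ← abs_of_pos hRc, ← abs_of_nonneg (norm_nonneg _),
      ← sq_lt_sq, Complex.sq_norm, Complex.normSq_apply]
    simp only [Complex.sub_re, Complex.ofReal_re, Complex.sub_im, Complex.ofReal_im]
    nlinarith
  obtain ⟨F, hF⟩ := (hf.mono hball).isExactOn_ball
  obtain ⟨S, hS, C, hC⟩ := h.exists_differentiableAt_norm_deriv_le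
  have hFc : ContinuousOn F (Metric.ball (R : ℂ) (R - c)) :=
    fun z hz => (hF z hz).continuousAt.continuousWithinAt
  have hfc : ContinuousOn f (Metric.ball (R : ℂ) (R - c)) := (hf.mono hball).continuousOn
  have := integral_eq_of_hasDerivAt_off_countable_of_le (fun u => F (γ u))
    (fun u => f (γ u) * deriv γ u) zero_le_one hS (hFc.comp h.continuousOn hγ)
    (fun u hu => by
      have := (hF (γ u) (hγ u (Ioo_subset_Icc_self hu.1))).scomp u (hC u hu).1.hasDerivAt
      simpa [mul_comm, Function.comp_def] using this)
    (h.intervalIntegrable_mul_deriv (hfc.comp h.continuousOn hγ))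
  rw [contourIntegral, this, h.closed, sub_self]

/-- Cauchy's integral formula for a function holomorphic in a half-plane. -/
theorem IsClosedContour.contourIntegral_div_sub {γ : ℝ → ℂ} (h : IsClosedContour γ) {c : ℝ}
    (hre : ∀ u ∈ Icc (0 : ℝ) 1, c < (γ u).re) {f : ℂ → ℂ}
    (hf : DifferentiableOn ℂ f {s | c < s.re}) {a : ℂ} (ha : c < a.re)
    (hne : ∀ u ∈ Icc (0 : ℝ) 1, γ u ≠ a) :
    contourIntegral γ (fun s => f s / (s - a)) =
      2 * Real.pi * Complex.I * windingNumber γ a * f a := by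
  have hopen : IsOpen {s : ℂ | c < s.re} := isOpen_lt continuous_const Complex.continuous_re
  have hds := (Complex.differentiableOn_dslope (hopen.mem_nhds ha)).2 hf
  have h0 := h.contourIntegral_eq_zero hre hds
  have hi1 := h.intervalIntegrable_mul_deriv (g := fun u => dslope f a (γ u))
    (hds.continuousOn.comp h.continuousOn hre)
  have hi2 := (h.intervalIntegrable_mul_deriv (g := fun u => (γ u - a)⁻¹)
    ((h.continuousOn.sub continuousOn_const).inv₀
      fun u hu => sub_ne_zero.2 (hne u hu))).mul_const (f a)
  have key : contourIntegral γ (fun s => f s / (s - a)) =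
      (∫ u in (0 : ℝ)..1, dslope f a (γ u) * deriv γ u) +
        ∫ u in (0 : ℝ)..1, (γ u - a)⁻¹ * deriv γ u * f a := by
    rw [← intervalIntegral.integral_add hi1 hi2, contourIntegral]
    refine intervalIntegral.integral_congr fun u hu => ?_
    rw [uIcc_of_le zero_le_one] at hu
    have hsub : γ u - a ≠ 0 := sub_ne_zero.2 (hne u hu)
    simp only [dslope_of_ne f (hne u hu), slope_def_field]
    field_simp
    ring
  rw [key, intervalIntegral.integral_mul_const]
  have h0' : (∫ u in (0 : ℝ)..1, dslope f a (γ u) * deriv γ u) = 0 := h0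
  rw [h0', windingNumber, contourIntegral]
  have hpi : (Real.pi : ℂ) ≠ 0 := by exact_mod_cast Real.pi_ne_zero
  field_simp [Complex.I_ne_zero]
  ring

/-! ### The Gamma function on vertical lines -/

theorem norm_Gamma_le {z : ℂ} (hz : 0 < z.re) : ‖Complex.Gamma z‖ ≤ Real.Gamma z.re := by
  rw [Complex.Gamma_eq_integral hz, Complex.GammaIntegral, Real.Gamma_eq_integral hz]
  refine (norm_integral_le_integral_norm _).trans_eq ?_
  refine setIntegral_congr_fun measurableSet_Ioi fun x hx => ?_
  rw [mem_Ioi] at hx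
  simp only [norm_mul, Complex.norm_real, Real.norm_eq_abs, Real.abs_exp,
    Complex.norm_cpow_eq_rpow_re_of_pos hx, Complex.sub_re, Complex.one_re]

/-- On vertical lines in the right half-plane `Γ` decays faster than any power: shift the
argument by the functional equation. -/
theorem norm_pow_mul_norm_Gamma_le (N : ℕ) {z : ℂ} (hz : 0 < z.re) :
    ‖z‖ ^ N * ‖Complex.Gamma z‖ ≤ Real.Gamma (z.re + N) := by
  induction N generalizing z with
  | zero => simpa using norm_Gamma_le hz
  | succ N ih =>
    have hz0 : z ≠ 0 := by rintro rfl; simp at hz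
    have hz1 : 0 < (z + 1).re := by simp; linarith
    have hle : ‖z‖ ≤ ‖z + 1‖ := by
      rw [← abs_of_nonneg (norm_nonneg z), ← abs_of_nonneg (norm_nonneg (z + 1)), ← sq_le_sq,
        Complex.sq_norm, Complex.sq_norm, Complex.normSq_apply, Complex.normSq_apply]
      simp only [Complex.add_re, Complex.one_re, Complex.add_im, Complex.one_im]
      nlinarith
    calc ‖z‖ ^ (N + 1) * ‖Complex.Gamma z‖ = ‖z‖ ^ N * ‖Complex.Gamma (z + 1)‖ := by
          rw [Complex.Gamma_add_one z hz0, norm_mul]; ring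
      _ ≤ ‖z + 1‖ ^ N * ‖Complex.Gamma (z + 1)‖ := by gcongr
      _ ≤ Real.Gamma ((z + 1).re + N) := ih hz1
      _ = Real.Gamma (z.re + (N + 1 : ℕ)) := by congr 1; push_cast; simp; ring

theorem continuousAt_Gamma_of_re_pos {z : ℂ} (hz : 0 < z.re) : ContinuousAt Complex.Gamma z :=
  Complex.continuousAt_Gamma z fun m h => by
    rw [h] at hz
    simp only [Complex.neg_re, Complex.natCast_re] at hz
    have := m.cast_nonneg (α := ℝ)
    linarith

theorem continuous_Gamma_comp {X : Type*} [TopologicalSpace X] {f : X → ℂ} (hf : Continuous f)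
    (h : ∀ x, 0 < (f x).re) : Continuous fun x => Complex.Gamma (f x) :=
  continuous_iff_continuousAt.2 fun x =>
    (continuousAt_Gamma_of_re_pos (h x)).comp (f := f) hf.continuousAt

theorem integrable_polynomial_mul_Gamma {σ : ℝ} (hσ : 0 < σ) (P : Polynomial ℂ) :
    Integrable fun τ : ℝ => P.eval ((σ + τ * Complex.I) / 2) *
      Complex.Gamma ((σ + τ * Complex.I) / 2) := by
  have hre : ∀ τ : ℝ, ((σ + τ * Complex.I) / 2 : ℂ).re = σ / 2 := fun τ => by simp
  have hre0 : ∀ τ : ℝ, 0 < ((σ + τ * Complex.I) / 2 : ℂ).re := fun τ => by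
    rw [hre]; positivity
  have hG : Continuous fun τ : ℝ => Complex.Gamma ((σ + τ * Complex.I) / 2) :=
    continuous_Gamma_comp (by fun_prop) hre0
  induction P using Polynomial.induction_on' with
  | add p q hp hq =>
    simp only [Polynomial.eval_add, add_mul]
    exact hp.add hq
  | monomial k a =>
    simp only [Polynomial.eval_monomial, mul_assoc]
    refine Integrable.const_mul ?_ a
    refine ((integrable_inv_one_add_sq).const_mul
      (4 * (1 + (σ ^ 2)⁻¹) * Real.Gamma (σ / 2 + (k + 2 : ℕ)))).mono'
      (Continuous.aestronglyMeasurable (by fun_prop)) (ae_of_all _ fun τ => ?_)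
    have h1 := norm_pow_mul_norm_Gamma_le (k + 2) (hre0 τ)
    rw [hre, pow_add] at h1
    set z : ℂ := (σ + τ * Complex.I) / 2 with hz
    have hzsq : ‖z‖ ^ 2 = (σ ^ 2 + τ ^ 2) / 4 := by
      rw [Complex.sq_norm, Complex.normSq_apply, hre]
      simp [hz]; ring
    have h2 : (1 + τ ^ 2) ≤ 4 * (1 + (σ ^ 2)⁻¹) * ‖z‖ ^ 2 := by
      rw [hzsq]
      have : σ ^ 2 * (σ ^ 2)⁻¹ = 1 := mul_inv_cancel₀ (by positivity)
      have h3 : 0 ≤ (σ ^ 2)⁻¹ * τ ^ 2 := by positivity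
      nlinarith [sq_nonneg σ]
    rw [norm_mul, norm_pow, ← div_eq_mul_inv, le_div_iff₀ (by positivity)]
    calc ‖z‖ ^ k * ‖Complex.Gamma z‖ * (1 + τ ^ 2)
        ≤ ‖z‖ ^ k * ‖Complex.Gamma z‖ * (4 * (1 + (σ ^ 2)⁻¹) * ‖z‖ ^ 2) := by gcongr
      _ = 4 * (1 + (σ ^ 2)⁻¹) * (‖z‖ ^ k * ‖z‖ ^ 2 * ‖Complex.Gamma z‖) := by ring
      _ ≤ _ := by gcongr

theorem Gamma_add_nat_eq_prod (n : ℕ) {z : ℂ} (hz : ∀ k < n, z + k ≠ 0) :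
    Complex.Gamma (z + n) = (∏ i : Fin n, (z + (i : ℕ))) * Complex.Gamma z := by
  rw [Fin.prod_univ_eq_prod_range (fun i => z + (i : ℂ)) n]
  induction n with
  | zero => simp
  | succ n ih =>
    rw [Finset.prod_range_succ, Nat.cast_succ, ← add_assoc,
      Complex.Gamma_add_one _ (hz n n.lt_succ_self), ih fun k hk => hz k (by omega)]
    ring

theorem ascPochhammer_eval_mul_Gamma (l : ℕ) {z : ℂ} (hz : 0 < z.re) :
    (ascPochhammer ℂ l).eval z * Complex.Gamma z = Complex.Gamma (z + l) := by
  rw [← Complex.Gamma_add_nat_div_Gamma_eq, div_mul_cancel₀ _ (Complex.Gamma_ne_zero_of_re_pos hz)]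
  intro k h
  rw [h] at hz
  simp only [Complex.neg_re, Complex.natCast_re] at hz
  have := k.cast_nonneg (α := ℝ)
  linarith

/-! ### Hankel matrices of Gamma values and Lagrange interpolation -/

/-- The matrix `(Γ(k + l + β) D_k)`; the even and the odd bi-moment matrices are of this form. -/
def gammaHankel (n : ℕ) (β : ℝ) (D : ℕ → ℝ) : Matrix (Fin n) (Fin n) ℝ :=
  Matrix.of fun k l => Real.Gamma ((k : ℕ) + (l : ℕ) + β) * D k

/-- Row `k` consists of the values at `k`, up to a common factor, of the monic polynomials
`(X + β)_l` of degree `l`, which gives a Vandermonde determinant. -/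
theorem det_gammaHankel_ne_zero (n : ℕ) {β : ℝ} (hβ : 0 < β) {D : ℕ → ℝ} (hD : ∀ k, D k ≠ 0) :
    (gammaHankel n β D).det ≠ 0 := by
  have hG : ∀ k : ℕ, 0 < Real.Gamma (k + β) := fun k => Real.Gamma_pos_of_pos (by positivity)
  have hasc : ∀ k l : ℕ, Real.Gamma (k + l + β) =
      Real.Gamma (k + β) * (ascPochhammer ℝ l).eval (k + β) := by
    intro k l
    induction l with
    | zero => simp
    | succ l ih =>
      rw [ascPochhammer_succ_eval, ← mul_assoc, ← ih, Nat.cast_succ,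
        show (k + (l + 1 : ℝ) + β) = (k + l + β) + 1 by ring,
        Real.Gamma_add_one (by positivity)]
      ring
  have heq : gammaHankel n β D =
      Matrix.diagonal (fun k : Fin n => Real.Gamma ((k : ℕ) + β) * D k) *
        Matrix.of (fun k l : Fin n =>
          ((ascPochhammer ℝ (l : ℕ)).comp (Polynomial.X + Polynomial.C β)).eval ((k : ℕ) : ℝ)) := by
    ext k l
    rw [Matrix.diagonal_mul]
    simp only [gammaHankel, Matrix.of_apply, hasc, Polynomial.eval_comp, Polynomial.eval_add,
      Polynomial.eval_X, Polynomial.eval_C]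
    ring
  have hmonic : ∀ i : Fin n,
      ((ascPochhammer ℝ (i : ℕ)).comp (Polynomial.X + Polynomial.C β)).Monic := fun i =>
    (monic_ascPochhammer ℝ i).comp_X_add_C β
  rw [heq, Matrix.det_mul, Matrix.det_diagonal,
    ← Matrix.det_eval_matrixOfPolynomials_eq_det_vandermonde (fun k : Fin n => ((k : ℕ) : ℝ)) _
      (fun i => by simp [Polynomial.natDegree_comp]) hmonic]
  refine mul_ne_zero (Finset.prod_ne_zero_iff.2 fun k _ => mul_ne_zero (hG k).ne' (hD k))
    (Matrix.det_vandermonde_ne_zero_iff.2 fun a b h => ?_)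
  exact Fin.ext (by exact_mod_cast h)

/-- The Lagrange basis polynomial that is `1` at the node `k` and `0` at the other nodes among
`0, …, n - 1`. -/
def lagrangeBasis (n : ℕ) (k : Fin n) : Polynomial ℂ :=
  Lagrange.basis Finset.univ (fun i : Fin n => ((i : ℕ) : ℂ)) k

theorem injOn_natCast_fin (n : ℕ) :
    Set.InjOn (fun i : Fin n => ((i : ℕ) : ℂ)) (Finset.univ : Finset (Fin n)) :=
  fun _ _ _ _ h => Fin.ext (Nat.cast_injective h)

theorem degree_lagrangeBasis_lt (n : ℕ) (k : Fin n) : (lagrangeBasis n k).degree < n := by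
  rw [lagrangeBasis, Lagrange.degree_basis (injOn_natCast_fin n) (Finset.mem_univ k),
    Finset.card_univ, Fintype.card_fin]
  have := k.pos
  exact_mod_cast Nat.sub_lt this one_pos

theorem eval_lagrangeBasis (n : ℕ) (k j : Fin n) :
    (lagrangeBasis n k).eval ((j : ℕ) : ℂ) = if k = j then 1 else 0 := by
  split_ifs with h
  · subst h
    exact Lagrange.eval_basis_self (injOn_natCast_fin n) (Finset.mem_univ k)
  · exact Lagrange.eval_basis_of_ne (v := fun i : Fin n => ((i : ℕ) : ℂ)) h (Finset.mem_univ j)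

/-- The columns of the inverse matrix are the coefficients of the Lagrange basis polynomials in
the basis of shifted factorials `(X + β)_l`. -/
theorem sum_inv_gammaHankel_mul_Gamma (n : ℕ) {β : ℝ} (hβ : 0 < β) {D : ℕ → ℝ}
    (hD : ∀ k, D k ≠ 0) (k : Fin n) {z : ℂ} (hz : 0 < z.re) :
    ∑ l : Fin n, (((gammaHankel n β D)⁻¹ l k : ℝ) : ℂ) * Complex.Gamma (z + (l : ℕ)) =
      (lagrangeBasis n k).eval (z - β) * Complex.Gamma z /
        (Complex.Gamma ((k : ℕ) + β) * D k) := by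
  have hGpos : ∀ k : ℕ, 0 < ((k : ℂ) + β).re := fun k => by simp; positivity
  have hGne : ∀ k : ℕ, Complex.Gamma ((k : ℂ) + β) ≠ 0 := fun k =>
    Complex.Gamma_ne_zero_of_re_pos (hGpos k)
  have hDne : ∀ k, (D k : ℂ) ≠ 0 := fun k => by exact_mod_cast hD k
  set P : Polynomial ℂ := ∑ l : Fin n, Polynomial.C (((gammaHankel n β D)⁻¹ l k : ℝ) : ℂ) *
    (ascPochhammer ℂ (l : ℕ)).comp (Polynomial.X + Polynomial.C (β : ℂ)) with hP
  have heval : ∀ v : ℂ, P.eval v = ∑ l : Fin n, (((gammaHankel n β D)⁻¹ l k : ℝ) : ℂ) *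
      (ascPochhammer ℂ (l : ℕ)).eval (v + β) := fun v => by
    simp [hP, Polynomial.eval_finsetSum]
  have hPQ : P = Polynomial.C (Complex.Gamma ((k : ℕ) + β) * D k)⁻¹ * lagrangeBasis n k := by
    refine Polynomial.eq_of_degrees_lt_of_eval_index_eq Finset.univ (injOn_natCast_fin n) ?_ ?_ ?_
    · rw [Finset.card_univ, Fintype.card_fin]
      rw [← Polynomial.mem_degreeLT]
      refine Submodule.sum_mem _ fun l _ => Polynomial.mem_degreeLT.2 ?_
      refine (Polynomial.degree_mul_le _ _).trans_lt ?_
      refine (add_le_add Polynomial.degree_C_le Polynomial.degree_le_natDegree).trans_lt ?_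
      rw [zero_add, Polynomial.natDegree_comp, ascPochhammer_natDegree,
        Polynomial.natDegree_X_add_C, mul_one]
      exact_mod_cast l.2
    · rw [Finset.card_univ, Fintype.card_fin]
      refine (Polynomial.degree_mul_le _ _).trans_lt ?_
      refine (add_le_add_left Polynomial.degree_C_le _).trans_lt ?_
      rw [zero_add]
      exact degree_lagrangeBasis_lt n k
    · intro j _
      have hunit : IsUnit (gammaHankel n β D).det := (det_gammaHankel_ne_zero n hβ hD).isUnit
      have hmul := congrFun (congrFun (Matrix.mul_nonsing_inv _ hunit) j) k
      rw [Matrix.mul_apply, Matrix.one_apply] at hmul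
      have hmulC := congrArg (fun r : ℝ => (r : ℂ)) hmul
      simp only [Complex.ofReal_sum, Complex.ofReal_mul, gammaHankel, Matrix.of_apply,
        ← Complex.Gamma_ofReal] at hmulC
      have h1 : P.eval ((j : ℕ) : ℂ) * (Complex.Gamma ((j : ℕ) + β) * D j) =
          ((if j = k then (1 : ℝ) else 0 : ℝ) : ℂ) := by
        rw [← hmulC, heval, Finset.sum_mul]
        refine Finset.sum_congr rfl fun l _ => ?_
        have := ascPochhammer_eval_mul_Gamma (l : ℕ) (hGpos j)
        push_cast
        rw [show ((j : ℕ) + (l : ℕ) + β : ℂ) = (j : ℕ) + β + (l : ℕ) by ring, ← this]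
        simp only [gammaHankel]
        ring
      rw [Polynomial.eval_mul, Polynomial.eval_C, eval_lagrangeBasis]
      rw [← eq_div_iff (mul_ne_zero (hGne j) (hDne j))] at h1
      rw [h1]
      by_cases hjk : j = k
      · subst hjk; simp
      · simp [hjk, Ne.symm hjk]
  have h2 := heval (z - β)
  rw [hPQ, Polynomial.eval_mul, Polynomial.eval_C, sub_add_cancel] at h2
  rw [div_eq_inv_mul, ← mul_assoc, h2, Finset.sum_mul]
  refine Finset.sum_congr rfl fun l _ => ?_
  rw [mul_assoc, ascPochhammer_eval_mul_Gamma _ hz]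

/-- Partial fractions in `v` of `∏ (i - w) / (∏ (i - v) (v - w))`, with residues given by the
Lagrange basis: both sides, multiplied by `v - w`, are polynomials in `w` of degree at most `n`
that agree at the nodes `0, …, n - 1` and at `v`. -/
theorem prod_sub_div_prod_sub (n : ℕ) {v w : ℂ} (hv : ∀ i : Fin n, v ≠ ((i : ℕ) : ℂ))
    (hvw : v ≠ w) :
    (∏ i : Fin n, (((i : ℕ) : ℂ) - w)) / (∏ i : Fin n, (((i : ℕ) : ℂ) - v)) / (v - w) =
      1 / (v - w) - ∑ k : Fin n, (lagrangeBasis n k).eval w / (v - (k : ℕ)) := by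
  classical
  have hN : ∏ i : Fin n, (((i : ℕ) : ℂ) - v) ≠ 0 :=
    Finset.prod_ne_zero_iff.2 fun i _ => sub_ne_zero.2 (hv i).symm
  set Q : Polynomial ℂ := ∑ k : Fin n, Polynomial.C ((v - (k : ℕ))⁻¹) * lagrangeBasis n k with hQ
  set T : Polynomial ℂ := ∏ i : Fin n, (Polynomial.C ((i : ℕ) : ℂ) - Polynomial.X) with hT
  have hTe : ∀ u, T.eval u = ∏ i : Fin n, (((i : ℕ) : ℂ) - u) := fun u => by
    simp [hT, Polynomial.eval_prod]
  have hQe : ∀ u, Q.eval u = ∑ k : Fin n, (lagrangeBasis n k).eval u / (v - (k : ℕ)) := fun u => by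
    simp [hQ, Polynomial.eval_finsetSum, div_eq_inv_mul]
  have hkey : (Polynomial.C v - Polynomial.X) * Q +
      Polynomial.C (∏ i : Fin n, (((i : ℕ) : ℂ) - v))⁻¹ * T = 1 := by
    set nodes : Finset ℂ := Finset.univ.image (fun i : Fin n => ((i : ℕ) : ℂ)) with hnodes
    have hvn : v ∉ nodes := by
      simp only [hnodes, Finset.mem_image, Finset.mem_univ, true_and, not_exists]
      exact fun i h => hv i h.symm
    have hcard : (insert v nodes).card = n + 1 := by
      rw [Finset.card_insert_of_notMem hvn, hnodes,
        Finset.card_image_of_injOn (injOn_natCast_fin n), Finset.card_univ, Fintype.card_fin]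
    have hlin : ∀ a : ℂ, (Polynomial.C a - Polynomial.X).degree ≤ 1 := fun a =>
      (Polynomial.degree_sub_le _ _).trans
        (max_le (Polynomial.degree_C_le.trans zero_le_one) Polynomial.degree_X_le)
    refine Polynomial.eq_of_degrees_lt_of_eval_finset_eq (insert v nodes) ?_ ?_ ?_
    · rw [hcard]
      refine (Polynomial.degree_add_le _ _).trans_lt (max_lt ?_ ?_)
      · have hQd : Q.degree < n := by
          rw [← Polynomial.mem_degreeLT]
          refine Submodule.sum_mem _ fun k _ => Polynomial.mem_degreeLT.2 ?_
          refine (Polynomial.degree_mul_le _ _).trans_lt ?_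
          refine (add_le_add_left Polynomial.degree_C_le _).trans_lt ?_
          rw [zero_add]
          exact degree_lagrangeBasis_lt n k
        refine (Polynomial.degree_mul_le _ _).trans_lt ?_
        refine (add_le_add_left (hlin v) _).trans_lt ?_
        rw [add_comm, Nat.cast_succ]
        exact WithBot.add_lt_add_right (by simp) hQd
      · have hTd : T.degree ≤ n := by
          refine (Polynomial.degree_prod_le _ _).trans ?_
          refine (Finset.sum_le_card_nsmul _ _ 1 fun i _ => hlin _).trans ?_
          simp
        refine (Polynomial.degree_mul_le _ _).trans_lt ?_
        refine (add_le_add Polynomial.degree_C_le hTd).trans_lt ?_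
        rw [zero_add]
        exact_mod_cast n.lt_succ_self
    · rw [hcard, Polynomial.degree_one]
      exact_mod_cast n.succ_pos
    · intro u hu
      rw [Finset.mem_insert] at hu
      simp only [Polynomial.eval_add, Polynomial.eval_mul, Polynomial.eval_sub, Polynomial.eval_C,
        Polynomial.eval_X, Polynomial.eval_one, hTe, hQe]
      rcases hu with rfl | hu
      · rw [sub_self, zero_mul, zero_add, inv_mul_cancel₀ hN]
      · obtain ⟨j, -, rfl⟩ := Finset.mem_image.1 hu
        rw [Finset.prod_eq_zero (f := fun i : Fin n => ((i : ℕ) : ℂ) - ((j : ℕ) : ℂ))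
          (Finset.mem_univ j) (sub_self _), mul_zero, add_zero,
          Finset.sum_eq_single j (fun k _ hk => by rw [eval_lagrangeBasis, if_neg hk, zero_div])
            (by simp), eval_lagrangeBasis, if_pos rfl]
        exact mul_one_div_cancel (sub_ne_zero.2 (hv j))
  have h := congrArg (Polynomial.eval w) hkey
  simp only [Polynomial.eval_add, Polynomial.eval_mul, Polynomial.eval_sub, Polynomial.eval_C,
    Polynomial.eval_X, Polynomial.eval_one, hTe, hQe] at h
  have hsub : v - w ≠ 0 := sub_ne_zero.2 hvw
  rw [div_eq_iff hsub, sub_mul, one_div_mul_cancel hsub, div_eq_mul_inv]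
  linear_combination h

/-! ### The weight functions and their Mellin transforms -/

theorem weight_neg (ν : ℕ → ℕ) (m j : ℕ) (x : ℝ) :
    weight ν m j (-x) = (-1) ^ j * weight ν m j x := by
  induction m generalizing x with
  | zero => simp only [weight]; rw [neg_pow x j, neg_sq]; ring
  | succ m ih =>
    simp only [weight, neg_div, ih]
    rw [← integral_const_mul]
    congr 1 with y
    ring

theorem stronglyMeasurable_weight (ν : ℕ → ℕ) (m j : ℕ) : StronglyMeasurable (weight ν m j) := by
  induction m with
  | zero =>
    have : weight ν 0 j = fun x => x ^ j * Real.exp (-x ^ 2) := funext fun x => by rw [weight]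
    rw [this]
    exact Continuous.stronglyMeasurable (by fun_prop)
  | succ m ih =>
    have : Measurable fun p : ℝ × ℝ =>
        p.2⁻¹ * p.2 ^ ν (m + 1) * Real.exp (-p.2) * weight ν m j (p.1 / p.2) := by
      have := ih.measurable
      fun_prop
    exact this.stronglyMeasurable.integral_prod_right'

/-- The Mellin transform `½ Γ((s + j)/2) ∏ Γ(ν_i + s)` of `weight ν m j` on the half-line. -/
def mellinWeight (ν : ℕ → ℕ) (m j : ℕ) (s : ℂ) : ℂ :=
  1 / 2 * Complex.Gamma ((s + j) / 2) * ∏ i ∈ Finset.Icc 1 m, Complex.Gamma (ν i + s)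

theorem mellinWeight_succ (ν : ℕ → ℕ) (m j : ℕ) (s : ℂ) :
    mellinWeight ν (m + 1) j s = mellinWeight ν m j s * Complex.Gamma (ν (m + 1) + s) := by
  rw [mellinWeight, Finset.prod_Icc_succ_top (by omega), ← mul_assoc, mellinWeight]

/-- The polynomial factor allows for `∏ (i - (t - ε)/2)` in the integrand of the kernel. -/
theorem integrable_polynomial_mul_mellinWeight (ν : ℕ → ℕ) (m j : ℕ) {σ : ℝ} (hσ : 0 < σ)
    (P : Polynomial ℂ) :
    Integrable fun τ : ℝ => P.eval ((σ + τ * Complex.I + j) / 2) *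
      mellinWeight ν m j (σ + τ * Complex.I) := by
  induction m with
  | zero =>
    have h := (integrable_polynomial_mul_Gamma (σ := σ + j) (by positivity) P).const_mul (1 / 2)
    refine h.congr (ae_of_all _ fun τ => ?_)
    simp only [mellinWeight, Finset.Icc_eq_empty_of_lt Nat.zero_lt_one, Finset.prod_empty]
    push_cast
    rw [show (σ + j + τ * Complex.I : ℂ) = σ + τ * Complex.I + j by ring]
    ring
  | succ m ih =>
    have hre : ∀ τ : ℝ, ((ν (m + 1) : ℂ) + (σ + τ * Complex.I)).re = ν (m + 1) + σ := fun τ => by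
      simp
    have hpos : ∀ τ : ℝ, 0 < ((ν (m + 1) : ℂ) + (σ + τ * Complex.I)).re := fun τ => by
      rw [hre]; positivity
    have hc := continuous_Gamma_comp
      (f := fun τ : ℝ => (ν (m + 1) : ℂ) + (σ + τ * Complex.I)) (by fun_prop) hpos
    refine (ih.mul_bdd (c := Real.Gamma (ν (m + 1) + σ)) hc.aestronglyMeasurable
      (ae_of_all _ fun τ => ?_)).congr (ae_of_all _ fun τ => ?_)
    · rw [← hre τ]
      exact norm_Gamma_le (hpos τ)
    · simp only [mellinWeight_succ]
      ring

theorem integrable_cpow_mul_mellinWeight (ν : ℕ → ℕ) (m j : ℕ) {σ : ℝ} (hσ : 0 < σ)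
    {x : ℝ} (hx : 0 < x) (P : Polynomial ℂ) :
    Integrable fun τ : ℝ => (x : ℂ) ^ (-(σ + τ * Complex.I)) *
      (P.eval ((σ + τ * Complex.I + j) / 2) * mellinWeight ν m j (σ + τ * Complex.I)) := by
  refine (integrable_polynomial_mul_mellinWeight ν m j hσ P).bdd_mul (c := x ^ (-σ)) ?_
    (ae_of_all _ fun τ => ?_)
  · have hx0 : (x : ℂ) ≠ 0 := by exact_mod_cast hx.ne'
    exact (Continuous.const_cpow (by fun_prop) (Or.inl hx0)).aestronglyMeasurable
  · rw [Complex.norm_cpow_eq_rpow_re_of_pos hx]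
    simp

theorem integrableOn_pow_mul_exp_neg (k : ℕ) :
    IntegrableOn (fun r : ℝ => r ^ k * Real.exp (-r)) (Ioi 0) := by
  have := Real.GammaIntegral_convergent (s := k + 1) (by positivity)
  simpa [mul_comm] using this

theorem mellin_pow_mul_exp_neg_sq (j : ℕ) {s : ℂ} (hs : 0 < s.re) :
    MellinConvergent (fun x : ℝ => ((x ^ j * Real.exp (-x ^ 2) : ℝ) : ℂ)) s ∧
      mellin (fun x : ℝ => ((x ^ j * Real.exp (-x ^ 2) : ℝ) : ℂ)) s =
        1 / 2 * Complex.Gamma ((s + j) / 2) := by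
  have hs' : 0 < ((s + j) / 2).re := by
    have : (0 : ℝ) ≤ j := j.cast_nonneg
    simp only [Complex.div_ofNat_re, Complex.add_re, Complex.natCast_re]
    linarith
  have heq : (fun x : ℝ => ((x ^ j * Real.exp (-x ^ 2) : ℝ) : ℂ)) =
      fun t : ℝ => (t : ℂ) ^ (j : ℂ) • ((fun u : ℝ => (Real.exp (-u) : ℂ)) (t ^ (2 : ℝ))) := by
    funext t
    simp
  rw [heq]
  constructor
  · rw [MellinConvergent.cpow_smul,
      MellinConvergent.comp_rpow (f := fun u : ℝ => (Real.exp (-u) : ℂ)) two_ne_zero]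
    have := Complex.GammaIntegral_convergent hs'
    simpa [MellinConvergent, mul_comm] using this
  · rw [mellin_cpow_smul, mellin_comp_rpow (fun u : ℝ => (Real.exp (-u) : ℂ)),
      ← Complex.GammaIntegral_eq_mellin, Complex.Gamma_eq_integral hs']
    simp

/-- Mellin inversion for the weight functions. For the Gaussian this is the general inversion
theorem; each further multiplicative convolution multiplies the transform by a Gamma factor, by
Fubini's theorem. -/
theorem weight_eq_mellinInv (ν : ℕ → ℕ) (m j : ℕ) {σ : ℝ} (hσ : 0 < σ) {x : ℝ} (hx : 0 < x) :
    (weight ν m j x : ℂ) = mellinInv σ (mellinWeight ν m j) x := by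
  induction m generalizing x with
  | zero =>
    have hre : ∀ τ : ℝ, 0 < ((σ : ℂ) + τ * Complex.I).re := fun τ => by simpa using hσ
    have hm : ∀ s : ℂ, 0 < s.re →
        mellin (fun x : ℝ => ((x ^ j * Real.exp (-x ^ 2) : ℝ) : ℂ)) s = mellinWeight ν 0 j s :=
      fun s hs => by rw [(mellin_pow_mul_exp_neg_sq j hs).2]; simp [mellinWeight]
    have hinv := mellinInv_mellin_eq σ (fun x : ℝ => ((x ^ j * Real.exp (-x ^ 2) : ℝ) : ℂ)) hx
      (mellin_pow_mul_exp_neg_sq j (by simpa using hσ)).1 ?_ ?_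
    · simp only [weight]
      rw [← hinv]
      simp only [mellinInv, hm _ (hre _)]
    · have := integrable_polynomial_mul_mellinWeight ν 0 j hσ 1
      refine this.congr (ae_of_all _ fun τ => ?_)
      simp only [hm _ (hre τ), Polynomial.eval_one, one_mul]
    · exact Continuous.continuousAt (by fun_prop)
  | succ m ih =>
    set k := ν (m + 1) with hk
    have hx0 : (x : ℂ) ≠ 0 := by exact_mod_cast hx.ne'
    -- `r ^ (-(σ + iτ))` is split into its modulus, put into the first factor, and a phase
    set F : ℝ → ℝ → ℂ := fun r τ =>
      ((Real.exp (-r) * r ^ (k + σ - 1) : ℝ) : ℂ) * ((x : ℂ) ^ (-(σ + τ * Complex.I)) *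
        mellinWeight ν m j (σ + τ * Complex.I)) * (r : ℂ) ^ (τ * Complex.I) with hF
    have hgm := integrable_cpow_mul_mellinWeight ν m j hσ hx 1
    simp only [Polynomial.eval_one, one_mul] at hgm
    have hFint : Integrable (Function.uncurry F)
        ((volume.restrict (Ioi (0 : ℝ))).prod volume) := by
      have h1 : Integrable (fun r : ℝ => ((Real.exp (-r) * r ^ (k + σ - 1) : ℝ) : ℂ))
          (volume.restrict (Ioi (0 : ℝ))) :=
        (Real.GammaIntegral_convergent (s := k + σ) (by positivity)).ofReal
      refine (h1.mul_prod hgm).mul_bdd (c := 1) ?_ ?_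
      · exact Measurable.aestronglyMeasurable (by fun_prop)
      · have : ∀ᵐ p : ℝ × ℝ ∂(volume.restrict (Ioi (0 : ℝ))).prod volume, p.1 ∈ Ioi (0 : ℝ) :=
          Measure.quasiMeasurePreserving_fst.ae (ae_restrict_mem measurableSet_Ioi)
        filter_upwards [this] with p hp
        rw [Complex.norm_cpow_eq_rpow_re_of_pos hp]
        simp
    have hstep : ∀ r ∈ Ioi (0 : ℝ),
        ((r⁻¹ * r ^ k * Real.exp (-r) * weight ν m j (x / r) : ℝ) : ℂ) =
          (1 / (2 * Real.pi) : ℝ) • ∫ τ : ℝ, F r τ := by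
      intro r hr
      rw [mem_Ioi] at hr
      have hr0 : (r : ℂ) ≠ 0 := by exact_mod_cast hr.ne'
      rw [Complex.ofReal_mul, ih (div_pos hx hr), mellinInv, mul_smul_comm,
        ← integral_const_mul]
      congr 2 with τ
      simp only [smul_eq_mul, hF]
      have e1 : ((x / r : ℝ) : ℂ) ^ (-(σ + τ * Complex.I)) =
          (x : ℂ) ^ (-(σ + τ * Complex.I)) * (r : ℂ) ^ (σ + τ * Complex.I : ℂ) := by
        rw [div_eq_mul_inv, Complex.ofReal_mul,
          Complex.mul_cpow_ofReal_nonneg hx.le (inv_nonneg.2 hr.le), Complex.ofReal_inv,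
          Complex.inv_cpow _ _ (by rw [Complex.arg_ofReal_of_nonneg hr.le]; exact Real.pi_pos.ne),
          Complex.cpow_neg (r : ℂ), inv_inv]
      have e2 : r ^ (k + σ - 1) = r⁻¹ * r ^ k * r ^ σ := by
        rw [Real.rpow_sub hr, Real.rpow_add hr, Real.rpow_one, Real.rpow_natCast]
        field_simp
      rw [e1, e2, Complex.cpow_add _ _ hr0]
      push_cast [Complex.ofReal_cpow hr.le]
      ring
    have hinner : ∀ τ : ℝ, ∫ r in Ioi (0 : ℝ), F r τ =
        (x : ℂ) ^ (-(σ + τ * Complex.I)) • mellinWeight ν (m + 1) j (σ + τ * Complex.I) := by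
      intro τ
      have hpos : 0 < ((k : ℂ) + (σ + τ * Complex.I)).re := by simp; positivity
      rw [mellinWeight_succ, ← hk, Complex.Gamma_eq_integral hpos, Complex.GammaIntegral,
        smul_eq_mul, ← mul_assoc, ← integral_const_mul]
      refine setIntegral_congr_fun measurableSet_Ioi fun r hr => ?_
      rw [mem_Ioi] at hr
      have hr0 : (r : ℂ) ≠ 0 := by exact_mod_cast hr.ne'
      simp only [hF]
      rw [show (k + (σ + τ * Complex.I) - 1 : ℂ) = ((k + σ - 1 : ℝ) : ℂ) + τ * Complex.I by
        push_cast; ring, Complex.cpow_add _ _ hr0]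
      push_cast [Complex.ofReal_cpow hr.le]
      ring
    rw [weight, ← integral_complex_ofReal, setIntegral_congr_fun measurableSet_Ioi hstep,
      integral_smul, integral_integral_swap hFint, mellinInv]
    simp only [hinner]

theorem exists_abs_weight_le (ν : ℕ → ℕ) (m j : ℕ) {σ : ℝ} (hσ : 0 < σ) :
    ∃ C : ℝ, 0 ≤ C ∧ ∀ x : ℝ, x ≠ 0 → |weight ν m j x| ≤ C * |x| ^ (-σ) := by
  have hpos : ∀ x : ℝ, 0 < x → |weight ν m j x| ≤
      (1 / (2 * Real.pi) * ∫ τ : ℝ, ‖mellinWeight ν m j (σ + τ * Complex.I)‖) * x ^ (-σ) := by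
    intro x hx
    rw [← Real.norm_eq_abs, ← Complex.norm_real, weight_eq_mellinInv ν m j hσ hx, mellinInv,
      norm_smul, mul_assoc, Real.norm_of_nonneg (by positivity)]
    gcongr
    refine (norm_integral_le_integral_norm _).trans_eq ?_
    rw [← integral_mul_const]
    congr 1 with τ
    rw [norm_smul, Complex.norm_cpow_eq_rpow_re_of_pos hx, mul_comm]
    simp
  refine ⟨1 / (2 * Real.pi) * ∫ τ : ℝ, ‖mellinWeight ν m j (σ + τ * Complex.I)‖,
    mul_nonneg (by positivity) (integral_nonneg fun τ => norm_nonneg _), fun x hx => ?_⟩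
  rcases hx.lt_or_gt with h | h
  · have h1 := hpos (-x) (neg_pos.2 h)
    rw [weight_neg, abs_mul, abs_pow, abs_neg, abs_one, one_pow, one_mul] at h1
    rwa [abs_of_neg h]
  · rw [abs_of_pos h]
    exact hpos x h

theorem integrableOn_weight_recursion (ν : ℕ → ℕ) (m j : ℕ) {z : ℝ} (hz : z ≠ 0) :
    IntegrableOn (fun r : ℝ => r⁻¹ * r ^ ν (m + 1) * Real.exp (-r) * weight ν m j (z / r))
      (Ioi 0) := by
  obtain ⟨C, hC0, hC⟩ := exists_abs_weight_le ν m j one_pos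
  have hm := (stronglyMeasurable_weight ν m j).measurable
  refine Integrable.mono' ((integrableOn_pow_mul_exp_neg (ν (m + 1))).const_mul (C * |z|⁻¹))
    (Measurable.aestronglyMeasurable (by fun_prop)) ?_
  filter_upwards [ae_restrict_mem measurableSet_Ioi] with r hr
  rw [mem_Ioi] at hr
  have h := hC (z / r) (div_ne_zero hz hr.ne')
  rw [Real.rpow_neg_one, abs_div, abs_of_pos hr, inv_div] at h
  rw [norm_mul, Real.norm_of_nonneg (by positivity), Real.norm_eq_abs]
  calc r⁻¹ * r ^ ν (m + 1) * Real.exp (-r) * |weight ν m j (z / r)|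
      ≤ r⁻¹ * r ^ ν (m + 1) * Real.exp (-r) * (C * (r / |z|)) := by gcongr
    _ = C * |z|⁻¹ * (r ^ ν (m + 1) * Real.exp (-r)) := by field_simp

/-- The bound by `x ^ (-σ)` is used with `σ = 1/2` near the origin and with `σ = k + 2` near
infinity. -/
theorem integrableOn_Ioi_pow_mul_weight (ν : ℕ → ℕ) (m j k : ℕ) :
    IntegrableOn (fun x : ℝ => x ^ k * weight ν m j x) (Ioi 0) := by
  have hm : Measurable fun x : ℝ => x ^ k * weight ν m j x := by
    have := (stronglyMeasurable_weight ν m j).measurable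
    fun_prop
  rw [← Ioc_union_Ioi_eq_Ioi (zero_le_one' ℝ), integrableOn_union]
  constructor
  · obtain ⟨C, hC0, hC⟩ := exists_abs_weight_le ν m j (σ := 1 / 2) (by norm_num)
    have hi : IntegrableOn (fun x : ℝ => x ^ (-(1 / 2) : ℝ)) (Ioc 0 1) := by
      rw [← intervalIntegrable_iff_integrableOn_Ioc_of_le zero_le_one]
      exact intervalIntegral.intervalIntegrable_rpow' (by norm_num)
    refine Integrable.mono' (hi.const_mul C) hm.aestronglyMeasurable ?_
    filter_upwards [ae_restrict_mem measurableSet_Ioc] with x hx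
    have h := hC x hx.1.ne'
    rw [abs_of_pos hx.1] at h
    rw [norm_mul, norm_pow, Real.norm_of_nonneg hx.1.le, Real.norm_eq_abs]
    calc x ^ k * |weight ν m j x| ≤ 1 * |weight ν m j x| := by
          gcongr; exact pow_le_one₀ hx.1.le hx.2
      _ ≤ _ := by rw [one_mul]; exact h
  · obtain ⟨C, hC0, hC⟩ := exists_abs_weight_le ν m j (σ := k + 2) (by positivity)
    have hi := integrableOn_Ioi_rpow_of_lt (a := -2) (by norm_num) one_pos
    refine Integrable.mono' (hi.const_mul C) hm.aestronglyMeasurable ?_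
    filter_upwards [ae_restrict_mem measurableSet_Ioi] with x hx
    have hx0 : (0 : ℝ) < x := one_pos.trans hx
    have h := hC x hx0.ne'
    rw [abs_of_pos hx0] at h
    rw [norm_mul, norm_pow, Real.norm_of_nonneg hx0.le, Real.norm_eq_abs]
    calc x ^ k * |weight ν m j x| ≤ x ^ k * (C * x ^ (-(k + 2) : ℝ)) := by gcongr
      _ = C * x ^ (-2 : ℝ) := by
          rw [← Real.rpow_natCast, mul_left_comm, ← Real.rpow_add hx0]
          congr 2
          ring

theorem pow_mul_weight_neg (ν : ℕ → ℕ) (m j k : ℕ) (x : ℝ) :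
    (-x) ^ k * weight ν m j (-x) = (-1) ^ (k + j) * (x ^ k * weight ν m j x) := by
  rw [weight_neg, neg_pow x k, pow_add]
  ring

theorem integrable_pow_mul_weight (ν : ℕ → ℕ) (m j k : ℕ) :
    Integrable fun x : ℝ => x ^ k * weight ν m j x := by
  have h := integrableOn_Ioi_pow_mul_weight ν m j k
  have hneg : IntegrableOn (fun x : ℝ => x ^ k * weight ν m j x) (Iio 0) := by
    have h1 := ((Measure.measurePreserving_neg (volume : Measure ℝ)).integrableOn_comp_preimage
      (Homeomorph.neg ℝ).measurableEmbedding).2 h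
    rw [show (Neg.neg ⁻¹' Ioi (0 : ℝ)) = Iio 0 by ext; simp] at h1
    have h2 := h1.const_mul ((-1) ^ (k + j))
    refine h2.congr (ae_of_all _ fun x => ?_)
    simp only [Function.comp_apply, pow_mul_weight_neg]
    rw [← mul_assoc, ← mul_pow]
    simp
  rw [← integrableOn_univ, ← Iic_union_Ioi (a := (0 : ℝ)), integrableOn_union]
  exact ⟨(integrableOn_Iic_iff_integrableOn_Iio).2 hneg, h⟩

/-- The Mellin transform of a weight at the positive integer `k + 1`: Fubini's theorem and the
substitution `x ↦ r x` split off one Gamma factor per convolution. -/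
theorem integral_Ioi_pow_mul_weight (ν : ℕ → ℕ) (m j k : ℕ) :
    ∫ x in Ioi (0 : ℝ), x ^ k * weight ν m j x =
      1 / 2 * Real.Gamma ((k + 1 + j) / 2) *
        ∏ i ∈ Finset.Icc 1 m, Real.Gamma (ν i + k + 1) := by
  induction m with
  | zero =>
    have h := (mellin_pow_mul_exp_neg_sq j (s := k + 1) (by simp; positivity)).2
    rw [mellin, show ((k + 1 + j : ℂ) / 2) = ((k + 1 + j) / 2 : ℝ) by push_cast; ring,
      Complex.Gamma_ofReal] at h
    simp only [Finset.Icc_eq_empty_of_lt Nat.zero_lt_one, Finset.prod_empty, mul_one, weight]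
    have h2 : ∀ x : ℝ, (x : ℂ) ^ ((k : ℂ) + 1 - 1) • ((x ^ j * Real.exp (-x ^ 2) : ℝ) : ℂ) =
        ((x ^ k * (x ^ j * Real.exp (-x ^ 2)) : ℝ) : ℂ) := fun x => by
      rw [add_sub_cancel_right, Complex.cpow_natCast]
      push_cast
      rfl
    simp only [h2] at h
    rw [integral_complex_ofReal] at h
    rw [← Complex.ofReal_inj, h]
    push_cast
    ring
  | succ m ih =>
    set p := ν (m + 1) with hp
    set h : ℝ → ℝ := fun x => x ^ k * weight ν m j x with hh
    have hhm : Measurable h := by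
      have := (stronglyMeasurable_weight ν m j).measurable
      fun_prop
    have hhi : IntegrableOn h (Ioi 0) := integrableOn_Ioi_pow_mul_weight ν m j k
    set G : ℝ → ℝ → ℝ := fun x r => (r ^ k * r⁻¹ * r ^ p * Real.exp (-r)) * h (r⁻¹ * x) with hG
    have hscale : ∀ (g : ℝ → ℝ), ∀ r ∈ Ioi (0 : ℝ),
        ∫ x in Ioi (0 : ℝ), (r ^ k * r⁻¹ * r ^ p * Real.exp (-r)) * g (r⁻¹ * x) =
          (r ^ (p + k) * Real.exp (-r)) * ∫ x in Ioi (0 : ℝ), g x := by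
      intro g r hr
      rw [mem_Ioi] at hr
      rw [integral_const_mul, integral_comp_mul_left_Ioi _ _ (inv_pos.2 hr), mul_zero, inv_inv,
        smul_eq_mul]
      field_simp
      ring
    have hGi : Integrable (Function.uncurry G)
        ((volume.restrict (Ioi (0 : ℝ))).prod (volume.restrict (Ioi (0 : ℝ)))) := by
      rw [integrable_prod_iff' (Measurable.aestronglyMeasurable (by fun_prop))]
      constructor
      · filter_upwards [ae_restrict_mem measurableSet_Ioi] with r hr
        simp only [Function.uncurry_apply_pair, hG]
        refine Integrable.const_mul ?_ _
        have := (integrableOn_Ioi_comp_mul_left_iff h 0 (inv_pos.2 hr)).2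
        rw [mul_zero] at this
        exact this hhi
      · refine ((integrableOn_pow_mul_exp_neg (p + k)).mul_const
          (∫ x in Ioi (0 : ℝ), ‖h x‖)).congr ?_
        filter_upwards [ae_restrict_mem measurableSet_Ioi] with r hr
        rw [← hscale (fun x => ‖h x‖) r hr]
        refine integral_congr_ae (ae_of_all _ fun x => ?_)
        rw [mem_Ioi] at hr
        simp only [Function.uncurry_apply_pair, hG, norm_mul]
        rw [← norm_mul, ← norm_mul, ← norm_mul, Real.norm_of_nonneg (r := r ^ k * r⁻¹ * r ^ p * _)
          (by positivity)]
    have hinner : ∀ x : ℝ, x ^ k * weight ν (m + 1) j x = ∫ r in Ioi (0 : ℝ), G x r := by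
      intro x
      rw [weight, ← integral_const_mul]
      refine setIntegral_congr_fun measurableSet_Ioi fun r hr => ?_
      rw [mem_Ioi] at hr
      simp only [hG, hh, ← hp, div_eq_inv_mul x r, mul_pow, inv_pow]
      field_simp
    have hGam : ∫ r in Ioi (0 : ℝ), r ^ (p + k) * Real.exp (-r) = Real.Gamma (p + k + 1) := by
      rw [Real.Gamma_eq_integral (by positivity)]
      refine setIntegral_congr_fun measurableSet_Ioi fun r _ => ?_
      rw [add_sub_cancel_right, ← Nat.cast_add, Real.rpow_natCast, mul_comm]
    simp only [hinner]
    rw [integral_integral_swap hGi, setIntegral_congr_fun measurableSet_Ioi (hscale h),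
      integral_mul_const, hGam, ih, Finset.prod_Icc_succ_top (by omega), ← hp]
    ring

/-! ### Bi-moments -/

theorem bimoment_eq (ν : ℕ → ℕ) (M k l : ℕ) :
    bimoment ν M k l = (1 + (-1) ^ (k + l)) * (1 / 2 * Real.Gamma ((k + 1 + l) / 2) *
      ∏ i ∈ Finset.Icc 1 M, Real.Gamma (ν i + k + 1)) := by
  have h := integrable_pow_mul_weight ν M l k
  rw [bimoment, ← intervalIntegral.integral_Iic_add_Ioi (b := 0) h.integrableOn h.integrableOn,
    ← integral_Ioi_pow_mul_weight ν M l k]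
  have h1 := integral_comp_neg_Iic 0 fun x : ℝ => x ^ k * weight ν M l x
  simp only [pow_mul_weight_neg, neg_zero, integral_const_mul] at h1
  have h2 : ((-1 : ℝ) ^ (k + l)) * (-1) ^ (k + l) = 1 := by rw [← mul_pow]; simp
  linear_combination (-1 : ℝ) ^ (k + l) * h1 -
    h2 * ∫ x in Iic (0 : ℝ), x ^ k * weight ν M l x

/-! ### The even and odd blocks -/

/-- The factor `∏ Γ(ν_i + 2k + ε + 1)` common to the entries in row `k` of the even (`ε = 0`) or
odd (`ε = 1`) bi-moment matrix. -/
def rowFactor (ν : ℕ → ℕ) (M ε k : ℕ) : ℝ :=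
  ∏ i ∈ Finset.Icc 1 M, Real.Gamma (ν i + (2 * k + ε) + 1)

theorem rowFactor_ne_zero (ν : ℕ → ℕ) (M ε k : ℕ) : rowFactor ν M ε k ≠ 0 :=
  Finset.prod_ne_zero_iff.2 fun _ _ => (Real.Gamma_pos_of_pos (by positivity)).ne'

/-- The matrix `(b_{2k+ε,2l+ε})` in closed form. -/
def blockMatrix (ν : ℕ → ℕ) (M ε n : ℕ) : Matrix (Fin n) (Fin n) ℝ :=
  gammaHankel n (ε + 1 / 2) (rowFactor ν M ε)

theorem isUnit_det_blockMatrix (ν : ℕ → ℕ) (M ε n : ℕ) : IsUnit (blockMatrix ν M ε n).det :=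
  (det_gammaHankel_ne_zero n (by positivity) (rowFactor_ne_zero ν M ε)).isUnit

/-- The even (`ε = 0`) and odd (`ε = 1`) kernels, with blocks of size `n`. -/
def blockKernel (ν : ℕ → ℕ) (M ε n : ℕ) (x y : ℝ) : ℝ :=
  ∑ k : Fin n, ∑ l : Fin n,
    (blockMatrix ν M ε n)⁻¹ l k * x ^ (2 * (k : ℕ) + ε) * weight ν M (2 * l + ε) y

theorem bimomentMatrixEven_eq (ν : ℕ → ℕ) (M n : ℕ) :
    bimomentMatrixEven ν M n = blockMatrix ν M 0 ((n + 1) / 2) := by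
  ext k l
  simp only [bimomentMatrixEven, blockMatrix, gammaHankel, rowFactor, Matrix.of_apply, bimoment_eq]
  rw [Even.neg_one_pow (by rw [← mul_add]; exact even_two_mul _)]
  push_cast
  rw [show ((2 * (k : ℕ) + 1 + 2 * (l : ℕ) : ℝ) / 2) = (k : ℕ) + (l : ℕ) + (0 + 1 / 2) by ring]
  ring_nf

theorem bimomentMatrixOdd_eq (ν : ℕ → ℕ) (M n : ℕ) :
    bimomentMatrixOdd ν M n = blockMatrix ν M 1 (n / 2) := by
  ext k l
  simp only [bimomentMatrixOdd, blockMatrix, gammaHankel, rowFactor, Matrix.of_apply, bimoment_eq]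
  rw [Even.neg_one_pow ⟨(k : ℕ) + l + 1, by ring⟩]
  push_cast
  rw [show ((2 * (k : ℕ) + 1 + 1 + (2 * (l : ℕ) + 1) : ℝ) / 2) =
    (k : ℕ) + (l : ℕ) + (1 + 1 / 2) by ring]
  ring_nf

theorem kernelEven_eq_blockKernel (ν : ℕ → ℕ) (M n : ℕ) (x y : ℝ) :
    kernelEven ν M n x y = blockKernel ν M 0 ((n + 1) / 2) x y := by
  simp only [kernelEven, blockKernel, bimomentMatrixEven_eq, add_zero]

theorem kernelOdd_eq_blockKernel (ν : ℕ → ℕ) (M n : ℕ) (x y : ℝ) :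
    kernelOdd ν M n x y = blockKernel ν M 1 (n / 2) x y := by
  simp only [kernelOdd, blockKernel, bimomentMatrixOdd_eq]

theorem bimoment_eq_zero_of_odd (ν : ℕ → ℕ) (M : ℕ) {k l : ℕ} (h : Odd (k + l)) :
    bimoment ν M k l = 0 := by
  rw [bimoment_eq, h.neg_one_pow]
  ring

/-- The even numbers followed by the odd numbers, as a rearrangement of `0, …, n - 1`. -/
def paritySplit (n : ℕ) : Fin ((n + 1) / 2) ⊕ Fin (n / 2) ≃ Fin n :=
  Equiv.ofBijective
    (Sum.elim (fun k => ⟨2 * k, by omega⟩) (fun k => ⟨2 * k + 1, by omega⟩)) (by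
      rw [Fintype.bijective_iff_injective_and_card]
      constructor
      · rintro (a | a) (b | b) h <;> simp [Fin.ext_iff] at h ⊢ <;> omega
      · simp only [Fintype.card_sum, Fintype.card_fin]
        omega)

theorem bimomentMatrix_submatrix (ν : ℕ → ℕ) (M n : ℕ) :
    (bimomentMatrix ν M n).submatrix (paritySplit n) (paritySplit n) =
      Matrix.fromBlocks (bimomentMatrixEven ν M n) 0 0 (bimomentMatrixOdd ν M n) := by
  ext a b
  rcases a with a | a <;> rcases b with b | b
  · rfl
  · exact bimoment_eq_zero_of_odd ν M (k := 2 * a) (l := 2 * b + 1) ⟨(a : ℕ) + b, by ring⟩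
  · exact bimoment_eq_zero_of_odd ν M (k := 2 * a + 1) (l := 2 * b) ⟨(a : ℕ) + b, by ring⟩
  · rfl

theorem isUnit_det_bimomentMatrix (ν : ℕ → ℕ) (M n : ℕ) :
    IsUnit (bimomentMatrix ν M n).det := by
  rw [← Matrix.det_submatrix_equiv_self (paritySplit n), bimomentMatrix_submatrix,
    Matrix.det_fromBlocks_zero₂₁, bimomentMatrixEven_eq, bimomentMatrixOdd_eq]
  exact (isUnit_det_blockMatrix ν M 0 _).mul (isUnit_det_blockMatrix ν M 1 _)

theorem kernel_eq_kernelEven_add_kernelOdd (ν : ℕ → ℕ) (M n : ℕ) (x y : ℝ) :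
    kernel ν M n x y = kernelEven ν M n x y + kernelOdd ν M n x y := by
  have hE : IsUnit (bimomentMatrixEven ν M n) := by
    rw [Matrix.isUnit_iff_isUnit_det, bimomentMatrixEven_eq]; exact isUnit_det_blockMatrix ν M 0 _
  have hO : IsUnit (bimomentMatrixOdd ν M n) := by
    rw [Matrix.isUnit_iff_isUnit_det, bimomentMatrixOdd_eq]; exact isUnit_det_blockMatrix ν M 1 _
  have hinv : ∀ a b, (bimomentMatrix ν M n)⁻¹ (paritySplit n a) (paritySplit n b) =
      Matrix.fromBlocks (bimomentMatrixEven ν M n)⁻¹ 0 0 (bimomentMatrixOdd ν M n)⁻¹ a b := by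
    intro a b
    have h := Matrix.inv_fromBlocks_zero₂₁_of_isUnit_iff (bimomentMatrixEven ν M n) 0
      (bimomentMatrixOdd ν M n) ⟨fun _ => hO, fun _ => hE⟩
    rw [← bimomentMatrix_submatrix, Matrix.inv_submatrix_equiv] at h
    simpa using congrFun (congrFun h a) b
  rw [kernel, ← (paritySplit n).sum_comp]
  simp_rw [← (paritySplit n).sum_comp
    (fun l => (bimomentMatrix ν M n)⁻¹ l _ * x ^ (_ : ℕ) * weight ν M l y), hinv]
  simp only [Fintype.sum_sum_type, Matrix.fromBlocks_apply₁₁, Matrix.fromBlocks_apply₁₂,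
    Matrix.fromBlocks_apply₂₁, Matrix.fromBlocks_apply₂₂, Matrix.zero_apply, zero_mul,
    Finset.sum_const_zero, add_zero, zero_add]
  rfl

theorem blockKernel_zero_abs (ν : ℕ → ℕ) (M n : ℕ) (x y : ℝ) :
    blockKernel ν M 0 n x y = blockKernel ν M 0 n |x| |y| := by
  have hw : ∀ l : ℕ, weight ν M (2 * l + 0) |y| = weight ν M (2 * l + 0) y := fun l => by
    rcases abs_choice y with h | h <;> rw [h]
    rw [weight_neg, add_zero, pow_mul]
    simp
  simp only [blockKernel, hw]
  simp only [add_zero, pow_mul, sq_abs]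

theorem blockKernel_one_abs (ν : ℕ → ℕ) (M n : ℕ) (x y : ℝ) (hx : x ≠ 0) (hy : y ≠ 0) :
    blockKernel ν M 1 n x y = Real.sign (x * y) * blockKernel ν M 1 n |x| |y| := by
  have hw : ∀ l : ℕ, weight ν M (2 * l + 1) y = Real.sign y * weight ν M (2 * l + 1) |y| := by
    intro l
    rcases hy.lt_or_gt with h | h
    · rw [abs_of_neg h, Real.sign_of_neg h, weight_neg, pow_succ, pow_mul]
      simp
    · rw [abs_of_pos h, Real.sign_of_pos h, one_mul]
  have hp : ∀ k : ℕ, x ^ (2 * k + 1) = Real.sign x * |x| ^ (2 * k + 1) := by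
    intro k
    rcases hx.lt_or_gt with h | h
    · rw [abs_of_neg h, Real.sign_of_neg h, Odd.neg_pow ⟨k, rfl⟩]
      ring
    · rw [abs_of_pos h, Real.sign_of_pos h, one_mul]
  have hs : Real.sign (x * y) = Real.sign x * Real.sign y := by
    rcases hx.lt_or_gt with h | h <;> rcases hy.lt_or_gt with h' | h'
    · rw [Real.sign_of_neg h, Real.sign_of_neg h', Real.sign_of_pos (mul_pos_of_neg_of_neg h h')]
      ring
    · rw [Real.sign_of_neg h, Real.sign_of_pos h', Real.sign_of_neg (mul_neg_of_neg_of_pos h h')]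
      ring
    · rw [Real.sign_of_pos h, Real.sign_of_neg h', Real.sign_of_neg (mul_neg_of_pos_of_neg h h')]
      ring
    · rw [Real.sign_of_pos h, Real.sign_of_pos h', Real.sign_of_pos (mul_pos h h')]
      ring
  simp only [blockKernel, hw, hp, hs, Finset.mul_sum]
  refine Finset.sum_congr rfl fun k _ => Finset.sum_congr rfl fun l _ => ?_
  ring

/-! ### The integrand -/

/-- Common form of the even (`ε = 0`) and odd (`ε = 1`) integrands; `x` and `y` stand for the moduli
of the arguments of the kernel. -/
def integrand (ν : ℕ → ℕ) (M ε n : ℕ) (x y : ℝ) (s t : ℂ) : ℂ :=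
  (x : ℂ) ^ s * (y : ℂ) ^ (-t - 1) / (s - t)
    * (Complex.Gamma ((ε - s) / 2) * Complex.Gamma ((t + 1 + ε) / 2)
        / (Complex.Gamma ((ε - t) / 2) * Complex.Gamma ((s + 1 + ε) / 2)))
    * (Complex.Gamma ((2 * n - t + ε) / 2) / Complex.Gamma ((2 * n - s + ε) / 2))
    * ∏ m ∈ Finset.Icc 1 M, Complex.Gamma (ν m + t + 1) / Complex.Gamma (ν m + s + 1)

theorem integrandEven_eq (ν : ℕ → ℕ) (M n : ℕ) (x y : ℝ) :
    integrandEven ν M n x y = integrand ν M 0 n |x| |y| := by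
  funext s t
  simp only [integrandEven, integrand, Nat.cast_zero, zero_sub, add_zero]

theorem integrandOdd_eq (ν : ℕ → ℕ) (M n : ℕ) (x y : ℝ) :
    integrandOdd ν M n x y = integrand ν M 1 n |x| |y| := by
  funext s t
  simp only [integrandOdd, integrand, Nat.cast_one, add_assoc, one_add_one_eq_two]

/-- The entire function of `s` in the integrand. -/
def contourFactor (ν : ℕ → ℕ) (M ε : ℕ) (x : ℝ) (s : ℂ) : ℂ :=
  (x : ℂ) ^ s * (Complex.Gamma ((s + 1 + ε) / 2))⁻¹ *
    ∏ m ∈ Finset.Icc 1 M, (Complex.Gamma (ν m + s + 1))⁻¹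

/-- The rapidly decaying function of `t` in the integrand. -/
def lineFactor (ν : ℕ → ℕ) (M ε : ℕ) (y : ℝ) (t : ℂ) : ℂ :=
  (y : ℂ) ^ (-t - 1) * Complex.Gamma ((t + 1 + ε) / 2) *
    ∏ m ∈ Finset.Icc 1 M, Complex.Gamma (ν m + t + 1)

theorem differentiable_contourFactor (ν : ℕ → ℕ) (M ε : ℕ) {x : ℝ} (hx : 0 < x) :
    Differentiable ℂ (contourFactor ν M ε x) := by
  have hx0 : (x : ℂ) ≠ 0 := by exact_mod_cast hx.ne'
  have hG := Complex.differentiable_one_div_Gamma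
  unfold contourFactor
  refine ((differentiable_id.const_cpow (Or.inl hx0)).mul
    (hG.comp (g := fun s => (Complex.Gamma s)⁻¹) (f := fun s : ℂ => (s + 1 + ε) / 2)
      (by fun_prop))).mul ?_
  exact Differentiable.fun_finsetProd fun m _ =>
    hG.comp (g := fun s => (Complex.Gamma s)⁻¹) (f := fun s : ℂ => ν m + s + 1) (by fun_prop)

/-- Away from the poles of `Γ((ε - s)/2)` the Gamma quotients reduce to a rational function. -/
theorem integrand_eq (ν : ℕ → ℕ) (M ε n : ℕ) (x y : ℝ) {s t : ℂ}
    (hs : ∀ k : ℕ, s ≠ 2 * k + ε) (ht : t.re < 0) :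
    integrand ν M ε n x y s t = contourFactor ν M ε x s * lineFactor ν M ε y t *
      ((∏ i : Fin n, (((i : ℕ) : ℂ) - (t - ε) / 2)) /
        (∏ i : Fin n, (((i : ℕ) : ℂ) - (s - ε) / 2)) / (s - t)) := by
  have hratio : ∀ z : ℂ, (∀ k : ℕ, z ≠ 2 * k + ε) →
      Complex.Gamma ((ε - z) / 2) ≠ 0 ∧ Complex.Gamma ((2 * n - z + ε) / 2) =
        (∏ i : Fin n, (((i : ℕ) : ℂ) - (z - ε) / 2)) * Complex.Gamma ((ε - z) / 2) := by
    intro z hz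
    have hne : ∀ k : ℕ, (ε - z) / 2 + k ≠ 0 := fun k h => hz k (by linear_combination (-2) * h)
    constructor
    · exact Complex.Gamma_ne_zero fun k h => hne k (by rw [h]; ring)
    · rw [show ((2 * n - z + ε) / 2 : ℂ) = (ε - z) / 2 + n by ring,
        Gamma_add_nat_eq_prod n fun k _ => hne k]
      congr 1
      exact Finset.prod_congr rfl fun i _ => by ring
  obtain ⟨hs1, hs2⟩ := hratio s hs
  obtain ⟨ht1, ht2⟩ := hratio t fun k h => by
    rw [h] at ht
    simp only [Complex.add_re, Complex.mul_re, Complex.re_ofNat, Complex.natCast_re,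
      Complex.im_ofNat, zero_mul, sub_zero] at ht
    have : (0 : ℝ) ≤ 2 * k + ε := by positivity
    linarith
  rw [integrand, contourFactor, lineFactor, hs2, ht2, Finset.prod_div_distrib,
    Finset.prod_inv_distrib]
  generalize Complex.Gamma ((ε - s) / 2) = a at hs1 ⊢
  generalize Complex.Gamma ((ε - t) / 2) = b at ht1 ⊢
  generalize Complex.Gamma ((s + 1 + ε) / 2) = d
  generalize (∏ i : Fin n, (((i : ℕ) : ℂ) - (s - ε) / 2)) = p
  generalize (∏ i : Fin n, (((i : ℕ) : ℂ) - (t - ε) / 2)) = q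
  generalize (∏ m ∈ Finset.Icc 1 M, Complex.Gamma (ν m + s + 1)) = e
  generalize (x : ℂ) ^ s = f
  generalize s - t = g
  simp only [div_eq_mul_inv, mul_inv]
  linear_combination (f * (y : ℂ) ^ (-t - 1) * g⁻¹ * Complex.Gamma ((t + 1 + ε) * 2⁻¹) * d⁻¹ * q *
    p⁻¹ * (∏ m ∈ Finset.Icc 1 M, Complex.Gamma (ν m + t + 1)) * e⁻¹) *
      ((a * a⁻¹) * mul_inv_cancel₀ ht1 + mul_inv_cancel₀ hs1)

/-- The contour may run through poles of `Γ((ε - s)/2)` that the integrand cancels, where the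
values `0` of `Γ` at its poles are not the limits; this does not affect the integrals. -/
theorem ae_integrand_mul_deriv_eq (ν : ℕ → ℕ) (M ε n : ℕ) (x y : ℝ) (γ : ℝ → ℂ) :
    ∀ᵐ u : ℝ, ∀ t : ℂ, t.re < 0 →
      integrand ν M ε n x y (γ u) t * deriv γ u =
        contourFactor ν M ε x (γ u) * lineFactor ν M ε y t *
          ((∏ i : Fin n, (((i : ℕ) : ℂ) - (t - ε) / 2)) /
            (∏ i : Fin n, (((i : ℕ) : ℂ) - (γ u - ε) / 2)) / (γ u - t)) * deriv γ u := by
  filter_upwards [ae_all_iff.2 fun k : ℕ => ae_eq_imp_deriv_eq_zero γ (2 * k + ε)] with u hu t ht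
  by_cases h : ∃ k : ℕ, γ u = 2 * k + ε
  · obtain ⟨k, hk⟩ := h
    rw [hu k hk, mul_zero, mul_zero]
  · rw [integrand_eq ν M ε n x y (not_exists.1 h) ht]

/-! ### The double contour integral -/

theorem IsClosedContour.contourIntegral_const_mul_sub_sum {γ : ℝ → ℂ} (h : IsClosedContour γ)
    {n : ℕ} (A : ℂ) (b : Fin n → ℂ) {f : ℂ → ℂ} {g : Fin n → ℂ → ℂ}
    (hf : ContinuousOn (fun u => f (γ u)) (Icc 0 1))
    (hg : ∀ k, ContinuousOn (fun u => g k (γ u)) (Icc 0 1)) :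
    contourIntegral γ (fun s => A * (f s - ∑ k, b k * g k s)) =
      A * (contourIntegral γ f - ∑ k, b k * contourIntegral γ (g k)) := by
  have hg' : ∀ k, IntervalIntegrable (fun u => b k * (g k (γ u) * deriv γ u)) volume 0 1 :=
    fun k => (h.intervalIntegrable_mul_deriv (hg k)).const_mul _
  have hsum : IntervalIntegrable (fun u => ∑ k, b k * (g k (γ u) * deriv γ u)) volume 0 1 := by
    simpa only [Finset.sum_fn] using IntervalIntegrable.sum Finset.univ fun k _ => hg' k
  simp only [contourIntegral, ← intervalIntegral.integral_const_mul]
  rw [← intervalIntegral.integral_finsetSum fun k _ => hg' k, ← intervalIntegral.integral_sub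
    (h.intervalIntegrable_mul_deriv hf) hsum,
    ← intervalIntegral.integral_const_mul]
  congr 1 with u
  rw [mul_assoc, sub_mul, Finset.sum_mul]
  simp only [mul_assoc]

/-- The `s`-integral, by residues at the points `2k + ε`. The factor `1/(s - t)` has its pole on
the line `Re s = c`, outside the half-plane of the contour, and contributes nothing. -/
theorem contourIntegral_integrand (ν : ℕ → ℕ) (M n : ℕ) {ε : ℕ} (hε : ε < 2) {x : ℝ} (hx : 0 < x)
    (y : ℝ) {c : ℝ} (hc' : c < 0) {γ : ℝ → ℂ} (hγ : Encircles γ (2 * n) c) {t : ℂ}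
    (ht : t.re = c) :
    contourIntegral γ (fun s => integrand ν M ε n x y s t) =
      2 * Real.pi * Complex.I * ∑ k : Fin n, contourFactor ν M ε x (2 * (k : ℕ) + ε) *
        ((lagrangeBasis n k).eval ((t - ε) / 2) * lineFactor ν M ε y t) := by
  have hcl := hγ.isClosedContour
  have hE := differentiable_contourFactor ν M ε hx
  have hnode : ∀ k : Fin n, ∀ u ∈ Icc (0 : ℝ) 1, γ u ≠ 2 * (k : ℕ) + ε := fun k u hu => by
    have := hγ.ne_natCast (2 * k + ε) (by omega) u hu
    exact_mod_cast this
  have hne : ∀ u ∈ Icc (0 : ℝ) 1, γ u ≠ t := fun u hu h => by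
    have := hγ.re_gt u hu
    rw [h, ht] at this
    exact lt_irrefl _ this
  have hEc : ContinuousOn (fun u => contourFactor ν M ε x (γ u)) (Icc 0 1) :=
    hE.continuous.comp_continuousOn hcl.continuousOn
  have hdiv : ∀ a : ℂ, (∀ u ∈ Icc (0 : ℝ) 1, γ u ≠ a) →
      ContinuousOn (fun u => contourFactor ν M ε x (γ u) / (γ u - a)) (Icc 0 1) := fun a ha =>
    hEc.div (hcl.continuousOn.sub continuousOn_const) fun u hu => sub_ne_zero.2 (ha u hu)
  have hpf : contourIntegral γ (fun s => integrand ν M ε n x y s t) =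
      contourIntegral γ (fun s => lineFactor ν M ε y t * (contourFactor ν M ε x s / (s - t) -
        ∑ k : Fin n, (lagrangeBasis n k).eval ((t - ε) / 2) *
          (contourFactor ν M ε x s / (s - (2 * (k : ℕ) + ε))))) := by
    refine contourIntegral_congr ?_
    filter_upwards [ae_restrict_mem measurableSet_Icc,
      ae_restrict_of_ae (ae_integrand_mul_deriv_eq ν M ε n x y γ)] with u hu h
    rw [h t (by rw [ht]; exact hc')]
    have h1 := prod_sub_div_prod_sub n (v := (γ u - ε) / 2) (w := (t - ε) / 2)
      (fun i hi => hnode i u hu (by linear_combination 2 * hi))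
      (fun hi => hne u hu (by linear_combination 2 * hi))
    rw [show (γ u - ε) / 2 - (t - ε) / 2 = (γ u - t) / 2 by ring] at h1
    have h2 : ∀ a : ℂ, a / (γ u - t) = 1 / 2 * (a / ((γ u - t) / 2)) := fun a => by
      rw [div_div_eq_mul_div]; ring
    have h3 : ∑ k : Fin n, (lagrangeBasis n k).eval ((t - ε) / 2) *
        (contourFactor ν M ε x (γ u) / (γ u - (2 * (k : ℕ) + ε))) =
        contourFactor ν M ε x (γ u) * (1 / 2 * ∑ k : Fin n,
          (lagrangeBasis n k).eval ((t - ε) / 2) / ((γ u - ε) / 2 - (k : ℕ))) := by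
      rw [Finset.mul_sum, Finset.mul_sum]
      refine Finset.sum_congr rfl fun k _ => ?_
      rw [show (γ u - ε) / 2 - ((k : ℕ) : ℂ) = (γ u - (2 * (k : ℕ) + ε)) / 2 by ring]
      generalize γ u - (2 * (k : ℕ) + ε) = a
      ring
    rw [h2, h1, h3]
    generalize γ u - t = a
    ring
  rw [hpf, hcl.contourIntegral_const_mul_sub_sum _ _ (hdiv t hne) fun k => hdiv _ (hnode k)]
  have h0 : contourIntegral γ (fun s => contourFactor ν M ε x s / (s - t)) = 0 := by
    refine hcl.contourIntegral_eq_zero hγ.re_gt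
      (hE.differentiableOn.div (by fun_prop) fun s hs h => ?_)
    rw [sub_eq_zero.1 h] at hs
    exact hs.ne' ht
  have hk : ∀ k : Fin n, contourIntegral γ
      (fun s => contourFactor ν M ε x s / (s - (2 * (k : ℕ) + ε))) =
        -(2 * Real.pi * Complex.I * contourFactor ν M ε x (2 * (k : ℕ) + ε)) := by
    intro k
    have hw := hγ.windingNumber_eq (2 * k + ε) (by omega)
    push_cast at hw
    rw [hcl.contourIntegral_div_sub hγ.re_gt hE.differentiableOn _ (hnode k), hw]
    · ring
    · have : (0 : ℝ) ≤ 2 * (k : ℕ) + ε := by positivity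
      simp
      linarith
  simp only [h0, hk, Finset.mul_sum, zero_sub, ← Finset.sum_neg_distrib]
  refine Finset.sum_congr rfl fun k _ => ?_
  ring

/-- The residue at `2k + ε`, expressed through Mellin transforms of the weight functions and the
inverse bi-moment matrix. -/
theorem residue_eq_sum_mellinWeight (ν : ℕ → ℕ) (M ε n : ℕ) {x : ℝ} (y : ℝ)
    (k : Fin n) {t : ℂ} (ht : -1 < t.re) :
    contourFactor ν M ε x (2 * (k : ℕ) + ε) *
        ((lagrangeBasis n k).eval ((t - ε) / 2) * lineFactor ν M ε y t) =
      ∑ l : Fin n, 2 * (((blockMatrix ν M ε n)⁻¹ l k * x ^ (2 * (k : ℕ) + ε) : ℝ) : ℂ) *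
        ((y : ℂ) ^ (-(t + 1)) * mellinWeight ν M (2 * l + ε) (t + 1)) := by
  have hz : 0 < ((t + 1 + ε) / 2).re := by
    have : (0 : ℝ) ≤ ε := ε.cast_nonneg
    simp only [Complex.div_ofNat_re, Complex.add_re, Complex.natCast_re, Complex.one_re]
    linarith
  have h := sum_inv_gammaHankel_mul_Gamma n (β := ε + 1 / 2) (by positivity)
    (rowFactor_ne_zero ν M ε) k hz
  have hD : ((rowFactor ν M ε k : ℝ) : ℂ) =
      ∏ m ∈ Finset.Icc 1 M, Complex.Gamma (ν m + (2 * (k : ℕ) + ε) + 1) := by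
    simp only [rowFactor, Complex.ofReal_prod, ← Complex.Gamma_ofReal]
    push_cast
    rfl
  push_cast at h
  rw [show (t + 1 + ε) / 2 - (ε + 1 / 2 : ℂ) = (t - ε) / 2 by ring, hD] at h
  have hx : (x : ℂ) ^ (2 * (k : ℕ) + ε : ℂ) = (x : ℂ) ^ (2 * (k : ℕ) + ε) := by
    rw [← Complex.cpow_natCast]
    push_cast
    rfl
  have hterm : ∀ l : Fin n, mellinWeight ν M (2 * l + ε) (t + 1) =
      1 / 2 * Complex.Gamma ((t + 1 + ε) / 2 + (l : ℕ)) *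
        ∏ m ∈ Finset.Icc 1 M, Complex.Gamma (ν m + t + 1) := fun l => by
    rw [mellinWeight]
    push_cast
    rw [show (t + 1 + (2 * (l : ℕ) + ε)) / 2 = (t + 1 + ε) / 2 + ((l : ℕ) : ℂ) by ring]
    simp only [add_assoc]
  simp only [contourFactor, lineFactor, hterm, Finset.prod_inv_distrib, hx]
  rw [show ((2 * (k : ℕ) + ε : ℂ) + 1 + ε) / 2 = (k : ℕ) + (ε + 1 / 2) by ring,
    show -(t + 1) = -t - 1 by ring]
  calc _ = (x : ℂ) ^ (2 * (k : ℕ) + ε) * (y : ℂ) ^ (-t - 1) *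
        (∏ m ∈ Finset.Icc 1 M, Complex.Gamma (ν m + t + 1)) *
        ((lagrangeBasis n k).eval ((t - ε) / 2) * Complex.Gamma ((t + 1 + ε) / 2) /
          (Complex.Gamma ((k : ℕ) + (ε + 1 / 2)) *
            ∏ m ∈ Finset.Icc 1 M, Complex.Gamma (ν m + (2 * (k : ℕ) + ε) + 1))) := by
        simp only [div_eq_mul_inv, mul_inv]
        ring
    _ = _ := by
        rw [← h, Finset.mul_sum]
        refine Finset.sum_congr rfl fun l _ => ?_
        rw [blockMatrix]
        push_cast
        ring

/-- The constants: the residues contribute `2πi`, the line element `i`, the factor `½` in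
`mellinWeight` a `2`, and Mellin inversion `2π`, in total `2 (2πi)²`. -/
theorem blockKernel_eq_doubleIntegral (ν : ℕ → ℕ) (M n : ℕ) {ε : ℕ} (hε : ε < 2) {x y : ℝ}
    (hx : 0 < x) (hy : 0 < y) {c : ℝ} (hc : -1 < c) (hc' : c < 0) {γ : ℝ → ℂ}
    (hγ : Encircles γ (2 * n) c) :
    (blockKernel ν M ε n x y : ℂ) = 1 / (2 * (2 * Real.pi * Complex.I) ^ 2) *
      verticalIntegral c (fun t => contourIntegral γ (fun s => integrand ν M ε n x y s t)) := by
  have hσ : 0 < c + 1 := by linarith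
  have hline : ∀ τ : ℝ, (c + τ * Complex.I + 1 : ℂ) = ((c + 1 : ℝ) : ℂ) + τ * Complex.I :=
    fun τ => by push_cast; ring
  have hinner : ∀ τ : ℝ,
      contourIntegral γ (fun s => integrand ν M ε n x y s (c + τ * Complex.I)) =
      2 * Real.pi * Complex.I * ∑ k : Fin n, ∑ l : Fin n,
        2 * (((blockMatrix ν M ε n)⁻¹ l k * x ^ (2 * (k : ℕ) + ε) : ℝ) : ℂ) *
          ((y : ℂ) ^ (-(((c + 1 : ℝ) : ℂ) + τ * Complex.I)) *
            mellinWeight ν M (2 * l + ε) (((c + 1 : ℝ) : ℂ) + τ * Complex.I)) := by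
    intro τ
    rw [contourIntegral_integrand ν M n hε hx y hc' hγ (by simp)]
    congr 1
    refine Finset.sum_congr rfl fun k _ => ?_
    rw [residue_eq_sum_mellinWeight ν M ε n y k (by simpa using hc), hline]
  have hint : ∀ l : Fin n, Integrable fun τ : ℝ =>
      (y : ℂ) ^ (-(((c + 1 : ℝ) : ℂ) + τ * Complex.I)) *
        mellinWeight ν M (2 * l + ε) (((c + 1 : ℝ) : ℂ) + τ * Complex.I) := fun l => by
    simpa using integrable_cpow_mul_mellinWeight ν M (2 * l + ε) hσ hy 1
  have hinv : ∀ l : Fin n, ∫ τ : ℝ, (y : ℂ) ^ (-(((c + 1 : ℝ) : ℂ) + τ * Complex.I)) *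
        mellinWeight ν M (2 * l + ε) (((c + 1 : ℝ) : ℂ) + τ * Complex.I) =
      2 * Real.pi * weight ν M (2 * l + ε) y := fun l => by
    rw [weight_eq_mellinInv ν M (2 * l + ε) hσ hy, mellinInv, Complex.real_smul]
    simp only [smul_eq_mul]
    have hpi : (Real.pi : ℂ) ≠ 0 := by exact_mod_cast Real.pi_ne_zero
    rw [show ((1 / (2 * Real.pi) : ℝ) : ℂ) = 1 / (2 * Real.pi) by push_cast; rfl, ← mul_assoc,
      mul_one_div_cancel (mul_ne_zero two_ne_zero hpi), one_mul]
  simp only [verticalIntegral, hinner]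
  rw [integral_const_mul, integral_finsetSum _ fun k _ => integrable_finsetSum _ fun l _ =>
    (hint l).const_mul _]
  simp_rw [integral_finsetSum _ fun (l : Fin n) _ => (hint l).const_mul _, integral_const_mul,
    hinv]
  simp only [blockKernel, Complex.ofReal_sum, Finset.mul_sum]
  refine Finset.sum_congr rfl fun k _ => Finset.sum_congr rfl fun l _ => ?_
  have hpi : (Real.pi : ℂ) ≠ 0 := by exact_mod_cast Real.pi_ne_zero
  push_cast
  field_simp [Complex.I_ne_zero]

/-- The double integral converges absolutely: up to null sets the integrand is a product of an
integrable function of `s`, an integrable function of `t` and the factor `1/(s - t)`, which is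
bounded because the contour has positive distance from the line. -/
theorem absolutelyConvergent_integrand (ν : ℕ → ℕ) (M n : ℕ) {ε : ℕ} (hε : ε < 2) {x y : ℝ}
    (hx : 0 < x) (hy : 0 < y) {c : ℝ} (hc : -1 < c) (hc' : c < 0) {γ : ℝ → ℂ}
    (hγ : Encircles γ (2 * n) c) :
    AbsolutelyConvergent c γ (integrand ν M ε n x y) := by
  have hcl := hγ.isClosedContour
  have hσ : 0 < c + 1 := by linarith
  have hnode : ∀ k : Fin n, ∀ u ∈ Icc (0 : ℝ) 1, γ u ≠ 2 * (k : ℕ) + ε := fun k u hu => by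
    have := hγ.ne_natCast (2 * k + ε) (by omega) u hu
    exact_mod_cast this
  have hs : Integrable (fun u => contourFactor ν M ε x (γ u) *
      (∏ i : Fin n, (((i : ℕ) : ℂ) - (γ u - ε) / 2))⁻¹ * deriv γ u)
      (volume.restrict (Icc (0 : ℝ) 1)) := by
    refine hcl.integrableOn_mul_deriv (ContinuousOn.mul
      ((differentiable_contourFactor ν M ε hx).continuous.comp_continuousOn hcl.continuousOn)
      (ContinuousOn.inv₀ (continuousOn_finsetProd _ fun i _ => continuousOn_const.sub
        ((hcl.continuousOn.sub continuousOn_const).div_const 2)) fun u hu => ?_))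
    exact Finset.prod_ne_zero_iff.2 fun i _ h =>
      hnode i u hu (by linear_combination (-2) * h)
  have ht : Integrable (fun τ : ℝ => lineFactor ν M ε y (c + τ * Complex.I) *
      ∏ i : Fin n, (((i : ℕ) : ℂ) - ((c + τ * Complex.I) - ε) / 2)) := by
    refine ((integrable_cpow_mul_mellinWeight ν M ε hσ hy (∏ i : Fin n,
      (Polynomial.C (((i : ℕ) : ℂ) + ε + 1 / 2) - Polynomial.X))).const_mul 2).congr
      (ae_of_all _ fun τ => ?_)
    simp only [lineFactor, mellinWeight, Polynomial.eval_prod, Polynomial.eval_sub,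
      Polynomial.eval_C, Polynomial.eval_X]
    push_cast
    rw [show (-(c + 1 + τ * Complex.I) : ℂ) = -(c + τ * Complex.I) - 1 by ring,
      show (c + 1 + τ * Complex.I + ε : ℂ) = c + τ * Complex.I + 1 + ε by ring,
      Finset.prod_congr rfl fun (i : Fin n) _ =>
        show (((i : ℕ) : ℂ) + ε + 1 / 2 - (c + τ * Complex.I + 1 + ε) / 2) =
          ((i : ℕ) : ℂ) - ((c + τ * Complex.I) - ε) / 2 by ring,
      Finset.prod_congr rfl fun (i : ℕ) _ =>
        show Complex.Gamma (ν i + (c + 1 + τ * Complex.I)) =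
          Complex.Gamma (ν i + (c + τ * Complex.I) + 1) by congr 1; ring]
    ring
  -- a lower bound for the distance between the contour and the line
  obtain ⟨C, hC⟩ := isCompact_Icc.exists_bound_of_continuousOn
    (f := fun u => ((γ u).re - c)⁻¹) (s := Icc (0 : ℝ) 1)
    (((Complex.continuous_re.comp_continuousOn hcl.continuousOn).sub continuousOn_const).inv₀
      fun u hu => (sub_pos.2 (hγ.re_gt u hu)).ne')
  have hmem : ∀ᵐ p : ℝ × ℝ ∂(volume.prod (volume.restrict (Icc (0 : ℝ) 1))),
      p.2 ∈ Icc (0 : ℝ) 1 :=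
    Measure.quasiMeasurePreserving_snd.ae (ae_restrict_mem measurableSet_Icc)
  have hmeas : AEStronglyMeasurable (fun p : ℝ × ℝ => (γ p.2 - (c + p.1 * Complex.I))⁻¹)
      (volume.prod (volume.restrict (Icc (0 : ℝ) 1))) := by
    have h1 : AEStronglyMeasurable γ (volume.restrict (Icc (0 : ℝ) 1)) :=
      hcl.continuousOn.aestronglyMeasurable measurableSet_Icc
    have h2 : AEStronglyMeasurable (fun p : ℝ × ℝ => γ p.2)
      ((volume : Measure ℝ).prod (volume.restrict (Icc (0 : ℝ) 1))) := h1.comp_snd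
    have h3 : Measurable fun p : ℝ × ℝ => (c + p.1 * Complex.I : ℂ) := by fun_prop
    exact (h2.aemeasurable.sub h3.aemeasurable).inv.aestronglyMeasurable
  refine ((ht.mul_prod hs).mul_bdd (c := C) hmeas ?_).congr ?_
  · filter_upwards [hmem] with p hp
    have hpos : 0 < (γ p.2).re - c := sub_pos.2 (hγ.re_gt _ hp)
    refine le_trans ?_ (hC _ hp)
    rw [norm_inv, norm_inv]
    refine inv_anti₀ (norm_pos_iff.2 hpos.ne') ?_
    have := Complex.abs_re_le_norm (γ p.2 - (c + p.1 * Complex.I))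
    simpa using this
  · have hae : ∀ᵐ p : ℝ × ℝ ∂(volume.prod (volume.restrict (Icc (0 : ℝ) 1))), _ :=
      Measure.quasiMeasurePreserving_snd.ae
        (ae_restrict_of_ae (ae_integrand_mul_deriv_eq ν M ε n x y γ))
    filter_upwards [hae] with p hp
    rw [hp _ (by simpa using hc')]
    simp only [div_eq_mul_inv]
    ring

end HermiteProduct

end

theorem proposition4p2 (M n : ℕ) (ν : ℕ → ℕ) (x y : ℝ) (hx : x ≠ 0) (hy : y ≠ 0)
    (c : ℝ) (hc : -1 < c) (hc' : c < 0)
    (γ : ℝ → ℂ) (hγ : HermiteProduct.Encircles γ (2 * n) c) :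
    -- the objects defining the kernels are meaningful
    (∀ m < M, ∀ (j : ℕ) (z : ℝ), z ≠ 0 → MeasureTheory.IntegrableOn
        (fun r : ℝ => r⁻¹ * r ^ ν (m + 1) * Real.exp (-r) * HermiteProduct.weight ν m j (z / r))
        (Set.Ioi 0)) ∧
    (∀ k l : ℕ, MeasureTheory.Integrable fun z : ℝ => z ^ k * HermiteProduct.weight ν M l z) ∧
    IsUnit (HermiteProduct.bimomentMatrix ν M (2 * n)).det ∧
    IsUnit (HermiteProduct.bimomentMatrixEven ν M (2 * n)).det ∧
    IsUnit (HermiteProduct.bimomentMatrixOdd ν M (2 * n)).det ∧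
    HermiteProduct.kernel ν M (2 * n) x y =
      HermiteProduct.kernelEven ν M (2 * n) x y + HermiteProduct.kernelOdd ν M (2 * n) x y ∧
    -- the even kernel
    HermiteProduct.AbsolutelyConvergent c γ (HermiteProduct.integrandEven ν M n x y) ∧
    (HermiteProduct.kernelEven ν M (2 * n) x y : ℂ) =
      1 / (2 * (2 * Real.pi * Complex.I) ^ 2) *
        HermiteProduct.verticalIntegral c (fun t =>
          HermiteProduct.contourIntegral γ (fun s =>
            HermiteProduct.integrandEven ν M n x y s t)) ∧
    -- the odd kernel
    HermiteProduct.AbsolutelyConvergent c γ (HermiteProduct.integrandOdd ν M n x y) ∧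
    (HermiteProduct.kernelOdd ν M (2 * n) x y : ℂ) =
      (Real.sign (x * y) : ℂ) / (2 * (2 * Real.pi * Complex.I) ^ 2) *
        HermiteProduct.verticalIntegral c (fun t =>
          HermiteProduct.contourIntegral γ (fun s =>
            HermiteProduct.integrandOdd ν M n x y s t)) := by
  have hx' : 0 < |x| := abs_pos.2 hx
  have hy' : 0 < |y| := abs_pos.2 hy
  refine ⟨fun m _ j z hz => HermiteProduct.integrableOn_weight_recursion ν m j hz,
    fun k l => HermiteProduct.integrable_pow_mul_weight ν M l k,
    HermiteProduct.isUnit_det_bimomentMatrix ν M _, ?_, ?_,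
    HermiteProduct.kernel_eq_kernelEven_add_kernelOdd ν M _ x y, ?_, ?_, ?_, ?_⟩
  · rw [HermiteProduct.bimomentMatrixEven_eq]
    exact HermiteProduct.isUnit_det_blockMatrix ν M 0 _
  · rw [HermiteProduct.bimomentMatrixOdd_eq]
    exact HermiteProduct.isUnit_det_blockMatrix ν M 1 _
  · rw [HermiteProduct.integrandEven_eq]
    exact HermiteProduct.absolutelyConvergent_integrand ν M n two_pos hx' hy' hc hc' hγ
  · rw [HermiteProduct.kernelEven_eq_blockKernel, show (2 * n + 1) / 2 = n by omega,
      HermiteProduct.blockKernel_zero_abs, HermiteProduct.integrandEven_eq]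
    exact HermiteProduct.blockKernel_eq_doubleIntegral ν M n two_pos hx' hy' hc hc' hγ
  · rw [HermiteProduct.integrandOdd_eq]
    exact HermiteProduct.absolutelyConvergent_integrand ν M n one_lt_two hx' hy' hc hc' hγ
  · rw [HermiteProduct.kernelOdd_eq_blockKernel, show 2 * n / 2 = n by omega,
      HermiteProduct.blockKernel_one_abs ν M n x y hx hy, Complex.ofReal_mul,
      HermiteProduct.blockKernel_eq_doubleIntegral ν M n one_lt_two hx' hy' hc hc' hγ,
      HermiteProduct.integrandOdd_eq]
    ring
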